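/- **Conventions.** A (non-stationary) subdivision scheme is given by a sequence of real Laurent polynomials (symbols) $a^{(k)}(z)=\sum_{i\in\mathbb Z}a^{(k)}_iz^i$, $k\ge 0$. From initial data $q^{(0)}=q$ it produces $q^{(k+1)}=S_{a^{(k)}}q^{(k)}$, where $(S_{a^{(k)}}q)_i=\sum_{j\in\mathbb Z}a^{(k)}_{i-2j}q_j$. The values $q^{(k)}_i$ are attached to parameters $t^{(k)}_i=\tau_k+i\,2^{-k}$ (usually $\tau_k=0$), and $Q^{(k)}$ denotes the function that is affine on each $[t^{(k)}_i,t^{(k)}_{i+1}]$ with $Q^{(k)}(t^{(k)}_i)=q^{(k)}_i$. A function $g:\mathbb R\to\mathbb C$ is the limit function for the data $q$ if $Q^{(k)}\to g$ uniformly on bounded intervals. The scheme is *convergent* if a limit function exists for all initial data and is not identically zero for at least one choice of them. Let $T\ge 0$ and $\gamma=(\gamma_0,\dots,\gamma_T)\in\mathbb C^{T+1}$ with $\gamma_T\ne 0$, and let $$V_{T,\gamma}=\Big\{f\in C^T(\mathbb R;\mathbb C):\ \sum_{j=0}^T\gamma_jD^jf=0\Big\}.$$ A scheme *generates* $V_{T,\gamma}$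 if it is convergent and, for every $f\in V_{T,\gamma}$, the limit function for the initial data $q_i=f(t^{(0)}_i)$ belongs to $V_{T,\gamma}$; it *reproduces* $V_{T,\gamma}$ if it is convergent and this limit function is $f$ itself, for every $f\in V_{T,\gamma}$. Assume that distinct zeros of $\gamma(z)=\sum_{j=0}^T\gamma_jz^j$ never differ by an integer multiple of $2\pi\mathrm i$. **Proposition.** Let $\widehat a^{(k)}(z)$, $k\ge0$, be real polynomials, $n(k)=\deg\widehat a^{(k)}$, such that $\widehat a^{(k)}(z)$ and $\widehat a^{(k)}(-z)$ are relatively prime for every $k\ge 0$. Put $\ell^+=2$ and $\ell^-=1$. Suppose that the scheme with symbols $\widehat a^{(k)}$ and parameters $t^{(k)}_i=\tau_k+i\,2^{-k}$, for some real $\tau_k$, generates $V_{T,\gamma}$. Then: 1. For all $k\ge0$, $\star\in\{+,-\}$ and $1\le i\le n(k)$ there is exactly one real polynomial $p=p_i^{(k),\star}$ of degree less than $n(k)$ such that $$\widehat a^{(k)}(z)\,p(z)\ \star\ \widehat a^{(k)}(-z)\,p(-z)=2z^{2i-\ell^\star}.$$ 2. For every choice of $\star=\star(k)\in\{+,-\}$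 and $i=i(k)$ with $1\le i(k)\le n(k)$, $k\ge0$, the scheme with symbols $$m^{(k)}_{i}(z)=\frac{\widehat a^{(k)}(z)\,p_{i}^{(k),\star}(z)}{z^{2i-\ell^\star}},\qquad k\ge 0$$ (so $m_i^{(k)}(z)=\widehat a^{(k)}(z)p_i^{(k)}(z)/z^{2i-1}$ for $\star=-$) and parameters $t^{(k)}_i=\tau+i\,2^{-k}$, for any fixed real $\tau$, reproduces the same space $V_{T,\gamma}$ whenever it is convergent. -/

import Mathlib

open Polynomial LaurentPolynomial Filter Topology

namespace ExpSubdivision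

noncomputable section

/-! ### Subdivision schemes -/

/-- The subdivision operator with real symbol `a(z) = ∑ aᵢ zⁱ` (a Laurent polynomial, so that the
mask `aᵢ` is finitely supported): `(S_a q)ᵢ = ∑_j a_{i-2j} q_j`. Only finitely many terms of the
sum are non-zero. Data are complex so that complex-valued functions can be sampled. -/
def subdivOp (a : ℝ[T;T⁻¹]) (q : ℤ → ℂ) : ℤ → ℂ :=
  fun i => ∑ᶠ j : ℤ, (a.coeff (i - 2 * j) : ℂ) * q j

/-- The data `q^{(k)} = S_{a^{(k-1)}} ⋯ S_{a^{(0)}} q` produced by `k` steps of the scheme. -/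
def subdivData (a : ℕ → ℝ[T;T⁻¹]) (q : ℤ → ℂ) : ℕ → ℤ → ℂ
  | 0 => q
  | k + 1 => subdivOp (a k) (subdivData a q k)

/-- The parameter value `t_i^{(k)} = τ_k + i / 2^k`. Every choice of parameters with
`t_{i+1}^{(k)} - t_i^{(k)} = 2^{-k}` is of this form; the usual choice is `τ = 0`. -/
def gridPoint (τ : ℕ → ℝ) (k : ℕ) (i : ℤ) : ℝ := τ k + (i : ℝ) / 2 ^ k

/-- The function on `ℝ` that takes the value `q i` at `gridPoint τ k i` and is affine between
consecutive grid points. -/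
def polygon (τ : ℕ → ℝ) (k : ℕ) (q : ℤ → ℂ) (x : ℝ) : ℂ :=
  let u : ℝ := (x - τ k) * 2 ^ k
  ((1 - Int.fract u : ℝ) : ℂ) * q ⌊u⌋ + ((Int.fract u : ℝ) : ℂ) * q (⌊u⌋ + 1)

/-- `g` is the limit function of the scheme with symbols `a` for the initial data `q`: the
piecewise linear interpolants converge to `g`, uniformly on bounded intervals. -/
def IsLimitFunction (τ : ℕ → ℝ) (a : ℕ → ℝ[T;T⁻¹]) (q : ℤ → ℂ) (g : ℝ → ℂ) : Prop :=
  TendstoLocallyUniformly (fun k => polygon τ k (subdivData a q k)) g atTop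

/-- Convergence of a subdivision scheme: there is a limit function for all initial data, and it is
not identically zero for at least one choice of the initial data. -/
def Convergent (τ : ℕ → ℝ) (a : ℕ → ℝ[T;T⁻¹]) : Prop :=
  (∀ q : ℤ → ℂ, ∃ g : ℝ → ℂ, IsLimitFunction τ a q g) ∧
    ∃ (q : ℤ → ℂ) (g : ℝ → ℂ), IsLimitFunction τ a q g ∧ g ≠ 0

/-! ### Exponential polynomials -/

/-- The space `V_{T,γ}` of all `f : ℝ → ℂ` of class `C^T` with `∑_{j=0}^T γ_j D^j f = 0`. -/
def expPolySpace (T : ℕ) (γ : Fin (T + 1) → ℂ) : Set (ℝ → ℂ) :=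
  {f | ContDiff ℝ T f ∧ ∀ x : ℝ, ∑ j : Fin (T + 1), γ j * iteratedDeriv (j : ℕ) f x = 0}

/-- The polynomial `γ(z) = ∑_{j=0}^T γ_j z^j`. -/
def charPoly {T : ℕ} (γ : Fin (T + 1) → ℂ) : ℂ[X] :=
  ∑ j : Fin (T + 1), Polynomial.C (γ j) * Polynomial.X ^ (j : ℕ)

/-- The scheme is convergent and, from the samples of any `f ∈ V`, yields a limit function that
belongs to `V`. -/
def Generates (τ : ℕ → ℝ) (a : ℕ → ℝ[T;T⁻¹]) (V : Set (ℝ → ℂ)) : Prop :=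
  Convergent τ a ∧
    ∀ f ∈ V, ∃ g ∈ V, IsLimitFunction τ a (fun i => f (gridPoint τ 0 i)) g

/-- The scheme is convergent and, from the samples of any `f ∈ V`, yields the limit function `f`. -/
def Reproduces (τ : ℕ → ℝ) (a : ℕ → ℝ[T;T⁻¹]) (V : Set (ℝ → ℂ)) : Prop :=
  Convergent τ a ∧
    ∀ f ∈ V, IsLimitFunction τ a (fun i => f (gridPoint τ 0 i)) f

/-! ### From approximating to interpolatory symbols -/

/-- The choice `⋆ ∈ {+, -}`. -/
inductive Star
  | plus
  | minus

/-- The sign `±1` of `⋆`. -/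
def Star.sign : Star → ℝ
  | .plus => 1
  | .minus => -1

/-- The number `ℓ^⋆`: it is `2` for `+` and `1` for `-`. -/
def Star.ell : Star → ℕ
  | .plus => 2
  | .minus => 1

/-- The polynomial `a(-z)`. -/
def negArg (a : ℝ[X]) : ℝ[X] := a.comp (-Polynomial.X)

/-- `p` is the polynomial `p_i^⋆` attached to the degree-`n` polynomial `a`: it has degree less
than `n` and `a(z) p(z) ⋆ a(-z) p(-z) = 2 z^{2i - ℓ^⋆}`. (Used for `1 ≤ i`, where the subtraction
of natural numbers is the usual one.) -/
def IsBezoutPoly (a : ℝ[X]) (s : Star) (i : ℕ) (p : ℝ[X]) : Prop :=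
  p.degree < (a.natDegree : WithBot ℕ) ∧
    a * p + Polynomial.C s.sign * (negArg a * negArg p)
      = 2 * Polynomial.X ^ (2 * i - s.ell)

/-- The Laurent polynomial `a(z) p(z) / z^{2i - ℓ^⋆}`; for `⋆ = -` the denominator is
`z^{2i-1}`. -/
def interpSymbol (a : ℝ[X]) (s : Star) (i : ℕ) (p : ℝ[X]) : ℝ[T;T⁻¹] :=
  Polynomial.toLaurent (a * p) * LaurentPolynomial.T (-(2 * (i : ℤ) - (s.ell : ℤ)))

end

end ExpSubdivision

/-! The operator `Q` sending initial data to the limit function is linear, commutes with integer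
shifts and, on `[0, 1]`, sees only finitely many data. It is studied through the entire function
`F(Λ) = ∫₀¹ e^{-Λx} Q(e^{Λ(c+·)})(x) dx` (`moment Q c 0`). Its derivatives are the moments with a
polynomial factor, and its values at `Λ + 2πi m` are, up to nonzero factors, the Fourier
coefficients of a 1-periodic function built from `Q`.

For the piecewise linear interpolants, `F` is the product of the values `a^{(j)}(e^{-Λ/2^{j+1}})/2`
times an explicit factor that does not vanish on a given disc for large `k`
(`moment_schemePolygon`). The `F` of the limit operator is the locally uniform limit of these. Three
facts then combine. (1) Generation forces `F` to vanish at `θ + 2πi m`, `m ≠ 0`, to at least the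
multiplicity of the characteristic root `θ` (`moment_eq_zero_of_generates`); the separation of the
roots modulo `2πi` enters here. (2) A zero of the limit is already a zero, of at least the same
order, of a finite product of symbols (`exists_le_analyticOrderAt_prod`). The new symbols are
Laurent multiples of the old ones, so their products and the moments of their limit operator inherit
these zeros. (3) With these zeros the relevant periodic functions are constant. The Bezout identity
makes the new symbols interpolatory, which determines the constants and gives reproduction
(`map_samples_eq`).

Part 1 is the Bezout identity for coprime polynomials with degree bounds. Uniqueness of the
bounded-degree solution and the symmetry `z ↦ -z` tie the two cofactors together. -/

noncomputable section

namespace ExpSubdivision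

/-! ### The subdivision operator -/

/-- Substituting `l = i - 2j` lets the sum run over the support of the mask, a finite set
independent of `q` and `i`; linearity and continuity then become termwise. -/
theorem subdivOp_eq_sum (a : ℝ[T;T⁻¹]) (q : ℤ → ℂ) (i : ℤ) :
    subdivOp a q i =
      a.coeff.sum fun l r => if 2 ∣ i - l then (r : ℂ) * q ((i - l) / 2) else 0 := by
  classical
  have hinj : Function.Injective fun j : ℤ => i - 2 * j := fun x y h => by
    simp only at h; omega
  unfold subdivOp
  rw [finsum_eq_sum_of_support_subset (s := a.coeff.support.preimage (fun j : ℤ => i - 2 * j)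
    hinj.injOn)]
  · rw [Finsupp.sum, ← Finset.sum_filter]
    refine Finset.sum_bij (fun j _ => i - 2 * j) ?_ ?_ ?_ ?_
    · intro j hj
      simp only [Finset.mem_preimage] at hj
      simp only [Finset.mem_filter, hj, true_and]
      exact ⟨j, by ring⟩
    · intro x _ y _ h
      exact hinj h
    · intro l hl
      simp only [Finset.mem_filter] at hl
      obtain ⟨j, hj⟩ := hl.2
      have hl' : i - 2 * j = l := by omega
      exact ⟨j, by simpa [hl'] using hl.1, hl'⟩
    · intro j _
      have : (i - (i - 2 * j)) / 2 = j := by omega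
      rw [this]
  · intro j hj
    simp only [Function.mem_support, ne_eq, mul_eq_zero, not_or] at hj
    simpa using hj.1

theorem subdivOp_add_left (a b : ℝ[T;T⁻¹]) (q : ℤ → ℂ) :
    subdivOp (a + b) q = subdivOp a q + subdivOp b q := by
  ext i
  simp only [Pi.add_apply, subdivOp_eq_sum, AddMonoidAlgebra.coeff_add]
  refine Finsupp.sum_add_index' (fun l => by simp) fun l x y => ?_
  split_ifs <;> simp [add_mul]

theorem subdivOp_C_mul_T (r : ℝ) (n : ℤ) (q : ℤ → ℂ) (i : ℤ) :
    subdivOp (LaurentPolynomial.C r * LaurentPolynomial.T n) q i =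
      if 2 ∣ i - n then (r : ℂ) * q ((i - n) / 2) else 0 := by
  rw [subdivOp_eq_sum, ← LaurentPolynomial.single_eq_C_mul_T, AddMonoidAlgebra.coeff_single,
    Finsupp.sum_single_index]
  simp

theorem subdivOp_add_right (a : ℝ[T;T⁻¹]) (q q' : ℤ → ℂ) :
    subdivOp a (q + q') = subdivOp a q + subdivOp a q' := by
  ext i
  simp only [Pi.add_apply, subdivOp_eq_sum, Finsupp.sum, ← Finset.sum_add_distrib]
  refine Finset.sum_congr rfl fun l _ => ?_
  split_ifs <;> ring

theorem subdivOp_smul_right (a : ℝ[T;T⁻¹]) (c : ℂ) (q : ℤ → ℂ) :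
    subdivOp a (c • q) = c • subdivOp a q := by
  ext i
  simp only [Pi.smul_apply, smul_eq_mul, subdivOp_eq_sum, Finsupp.sum, Finset.mul_sum]
  refine Finset.sum_congr rfl fun l _ => ?_
  split_ifs <;> ring

/-- Continuity is for the product topology on `ℤ → ℂ`, as the Baire argument in
`Convergent.exists_window` requires. -/
theorem continuous_subdivOp (a : ℝ[T;T⁻¹]) : Continuous (subdivOp a) := by
  refine continuous_pi fun i => ?_
  simp only [subdivOp_eq_sum, Finsupp.sum]
  refine continuous_finsetSum _ fun l _ => ?_
  split_ifs <;> fun_prop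

theorem subdivOp_shift (a : ℝ[T;T⁻¹]) (q : ℤ → ℂ) (n i : ℤ) :
    subdivOp a (fun j => q (j + n)) i = subdivOp a q (i + 2 * n) := by
  simp only [subdivOp_eq_sum, Finsupp.sum]
  refine Finset.sum_congr rfl fun l _ => ?_
  have h : 2 ∣ i - l ↔ 2 ∣ i + 2 * n - l := by omega
  by_cases hd : 2 ∣ i - l
  · rw [if_pos hd, if_pos (h.1 hd)]
    congr 2
    omega
  · rw [if_neg hd, if_neg (mt h.2 hd)]

theorem subdivData_add (a : ℕ → ℝ[T;T⁻¹]) (q q' : ℤ → ℂ) (k : ℕ) :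
    subdivData a (q + q') k = subdivData a q k + subdivData a q' k := by
  induction k with
  | zero => rfl
  | succ k ih => simp only [subdivData, ih, subdivOp_add_right]

theorem subdivData_smul (a : ℕ → ℝ[T;T⁻¹]) (c : ℂ) (q : ℤ → ℂ) (k : ℕ) :
    subdivData a (c • q) k = c • subdivData a q k := by
  induction k with
  | zero => rfl
  | succ k ih => simp only [subdivData, ih, subdivOp_smul_right]

theorem continuous_subdivData (a : ℕ → ℝ[T;T⁻¹]) (k : ℕ) :
    Continuous fun q => subdivData a q k := by
  induction k with
  | zero => exact continuous_id
  | succ k ih => exact (continuous_subdivOp (a k)).comp ih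

theorem subdivData_shift (a : ℕ → ℝ[T;T⁻¹]) (q : ℤ → ℂ) (n : ℤ) (k : ℕ) :
    ∀ i, subdivData a (fun j => q (j + n)) k i = subdivData a q k (i + 2 ^ k * n) := by
  induction k with
  | zero => intro i; simp [subdivData]
  | succ k ih =>
    intro i
    have : subdivData a (fun j => q (j + n)) k = fun i => subdivData a q k (i + 2 ^ k * n) :=
      funext ih
    simp only [subdivData, this, subdivOp_shift]
    congr 1
    ring

/-! ### Symbols at exponentials -/

/-- The value of a symbol at `e^{-Λ}`. -/
def symbolEval (a : ℝ[T;T⁻¹]) (Λ : ℂ) : ℂ :=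
  LaurentPolynomial.eval₂ Complex.ofRealHom (Units.mk0 (Complex.exp (-Λ)) (Complex.exp_ne_zero _)) a

theorem symbolEval_add (a b : ℝ[T;T⁻¹]) (Λ : ℂ) :
    symbolEval (a + b) Λ = symbolEval a Λ + symbolEval b Λ := map_add _ _ _

theorem symbolEval_mul (a b : ℝ[T;T⁻¹]) (Λ : ℂ) :
    symbolEval (a * b) Λ = symbolEval a Λ * symbolEval b Λ := map_mul _ _ _

theorem symbolEval_T (n : ℤ) (Λ : ℂ) :
    symbolEval (LaurentPolynomial.T n) Λ = Complex.exp (-(Λ * n)) := by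
  rw [symbolEval, LaurentPolynomial.eval₂_T, Units.val_zpow_eq_zpow_val, Units.val_mk0,
    ← Complex.exp_int_mul]
  ring_nf

theorem symbolEval_C (r : ℝ) (Λ : ℂ) : symbolEval (LaurentPolynomial.C r) Λ = r := by
  rw [symbolEval, LaurentPolynomial.eval₂_C]; rfl

theorem differentiable_symbolEval (a : ℝ[T;T⁻¹]) : Differentiable ℂ (symbolEval a) := by
  induction a using LaurentPolynomial.induction_on' with
  | add p q hp hq =>
    have : symbolEval (p + q) = fun Λ => symbolEval p Λ + symbolEval q Λ :=
      funext (symbolEval_add p q)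
    rw [this]
    exact hp.add hq
  | C_mul_T n r =>
    have : symbolEval (LaurentPolynomial.C r * LaurentPolynomial.T n)
        = fun Λ => (r : ℂ) * Complex.exp (-(Λ * n)) :=
      funext fun Λ => by rw [symbolEval_mul, symbolEval_C, symbolEval_T]
    rw [this]
    fun_prop

/-- The normalised product of the first `k` symbols, `∏_{j<k} a^{(j)}(e^{-Λ/2^{j+1}}) / 2`. -/
def symbolProd (a : ℕ → ℝ[T;T⁻¹]) (k : ℕ) (Λ : ℂ) : ℂ :=
  ∏ j ∈ Finset.range k, symbolEval (a j) (Λ / 2 ^ (j + 1)) / 2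

theorem differentiable_symbolProd (a : ℕ → ℝ[T;T⁻¹]) (k : ℕ) :
    Differentiable ℂ (symbolProd a k) := by
  unfold symbolProd
  refine Differentiable.fun_finsetProd fun j _ => ?_
  have := differentiable_symbolEval (a j)
  fun_prop

theorem sum_range_add_of_periodic {u : ℤ → ℂ} {N : ℕ} (hu : ∀ j, u (j + N) = u j) (s : ℤ) :
    ∑ i ∈ Finset.range N, u (i + s) = ∑ i ∈ Finset.range N, u i := by
  have step : ∀ s : ℤ, ∑ i ∈ Finset.range N, u (i + (s + 1)) = ∑ i ∈ Finset.range N, u (i + s) := by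
    intro s
    have h := Finset.sum_range_succ (fun i : ℕ => u (i + s)) N
    rw [Finset.sum_range_succ'] at h
    have hN : u ((N : ℤ) + s) = u (((0 : ℕ) : ℤ) + s) := by
      rw [← hu (((0 : ℕ) : ℤ) + s)]; congr 1; push_cast; ring
    rw [hN] at h
    have := add_right_cancel h
    rw [← this]
    refine Finset.sum_congr rfl fun i _ => ?_
    congr 1; push_cast; ring
  induction s using Int.induction_on with
  | zero => simp
  | succ n ih => rw [step, ih]
  | pred n ih => rw [← ih, ← step]; simp

theorem sum_range_two_mul_of_odd_eq_zero {f : ℤ → ℂ} (hf : ∀ i : ℤ, f (2 * i + 1) = 0) (N : ℕ) :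
    ∑ i ∈ Finset.range (2 * N), f i = ∑ j ∈ Finset.range N, f (2 * j) := by
  induction N with
  | zero => simp
  | succ N ih =>
    rw [mul_add, mul_one, Finset.sum_range_succ, Finset.sum_range_succ, ih, Finset.sum_range_succ]
    have := hf N
    push_cast
    rw [this, add_zero]

/-- Both sides are additive in the symbol, so a monomial `r z^n` suffices. One subdivision step thus
multiplies the discrete Fourier sum of quasi-periodic data by the symbol. -/
theorem sum_subdivOp_mul_exp (a : ℝ[T;T⁻¹]) (q : ℤ → ℂ) (Λ : ℂ) (N : ℕ)
    (hq : ∀ j, q (j + N) = Complex.exp (2 * Λ * N) * q j) :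
    ∑ i ∈ Finset.range (2 * N), subdivOp a q i * Complex.exp (-(Λ * i)) =
      symbolEval a Λ * ∑ j ∈ Finset.range N, q j * Complex.exp (-(2 * Λ * j)) := by
  induction a using LaurentPolynomial.induction_on' with
  | add a b ha hb =>
    rw [symbolEval_add, add_mul, ← ha, ← hb, ← Finset.sum_add_distrib]
    refine Finset.sum_congr rfl fun i _ => ?_
    rw [subdivOp_add_left, Pi.add_apply, add_mul]
  | C_mul_T n r =>
    have hper : ∀ i : ℤ, subdivOp (LaurentPolynomial.C r * LaurentPolynomial.T n) q
        (i + (2 * N : ℕ)) * Complex.exp (-(Λ * (i + (2 * N : ℕ) : ℤ))) =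
        subdivOp (LaurentPolynomial.C r * LaurentPolynomial.T n) q i *
          Complex.exp (-(Λ * i)) := by
      intro i
      have h1 := subdivOp_shift (LaurentPolynomial.C r * LaurentPolynomial.T n) q N i
      have h2 : (fun j => q (j + N)) = Complex.exp (2 * Λ * N) • q := funext hq
      rw [h2, subdivOp_smul_right] at h1
      push_cast
      rw [← h1, Pi.smul_apply, smul_eq_mul, mul_right_comm, ← Complex.exp_add, mul_comm]
      congr 2
      ring
    -- The summand has period `2N`, so the index may be shifted by `n`; afterwards only even indices
    -- contribute, and they return the original data.
    have h := sum_range_add_of_periodic (u := fun i : ℤ =>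
      subdivOp (LaurentPolynomial.C r * LaurentPolynomial.T n) q i * Complex.exp (-(Λ * i)))
      hper n
    push_cast at h
    rw [← h, symbolEval_mul, symbolEval_C, symbolEval_T]
    have h' := sum_range_two_mul_of_odd_eq_zero (f := fun i : ℤ =>
      subdivOp (LaurentPolynomial.C r * LaurentPolynomial.T n) q (i + n)
        * Complex.exp (-(Λ * (i + n)))) (fun i => by
          rw [subdivOp_C_mul_T, if_neg (by omega), zero_mul]) N
    push_cast at h'
    rw [h', Finset.mul_sum]
    refine Finset.sum_congr rfl fun j _ => ?_
    rw [subdivOp_C_mul_T, if_pos (by omega)]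
    have : (2 * (j : ℤ) + n - n) / 2 = j := by omega
    rw [this]
    have he : Complex.exp (-(Λ * (2 * j + n))) =
        Complex.exp (-(Λ * n)) * Complex.exp (-(2 * Λ * j)) := by
      rw [← Complex.exp_add]; congr 1; ring
    rw [he]
    ring

theorem subdivData_exp_add (a : ℕ → ℝ[T;T⁻¹]) (Λ c : ℂ) (k : ℕ) (i : ℤ) :
    subdivData a (fun j => Complex.exp (Λ * (c + j))) k (i + 2 ^ k) =
      Complex.exp Λ * subdivData a (fun j => Complex.exp (Λ * (c + j))) k i := by
  have h := subdivData_shift a (fun j => Complex.exp (Λ * (c + j))) 1 k i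
  have h2 : (fun j : ℤ => Complex.exp (Λ * (c + (j + 1 : ℤ)))) =
      Complex.exp Λ • fun j : ℤ => Complex.exp (Λ * (c + j)) := by
    ext j
    rw [Pi.smul_apply, smul_eq_mul, ← Complex.exp_add]
    congr 1; push_cast; ring
  rw [mul_one] at h
  rw [← h, h2, subdivData_smul, Pi.smul_apply, smul_eq_mul]

theorem sum_subdivData_exp (a : ℕ → ℝ[T;T⁻¹]) (Λ c : ℂ) (k : ℕ) :
    ∑ i ∈ Finset.range (2 ^ k), subdivData a (fun j => Complex.exp (Λ * (c + j))) k i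
        * Complex.exp (-(Λ / 2 ^ k * i)) =
      2 ^ k * (Complex.exp (Λ * c) * symbolProd a k Λ) := by
  induction k with
  | zero => simp [subdivData, symbolProd]
  | succ k ih =>
    have h := sum_subdivOp_mul_exp (a k) (subdivData a (fun j => Complex.exp (Λ * (c + j))) k)
      (Λ / 2 ^ (k + 1)) (2 ^ k) (fun i => by
        have := subdivData_exp_add a Λ c k i
        push_cast
        rw [this]
        congr 2
        field_simp
        ring)
    rw [← pow_succ'] at h
    have h2 : 2 * (Λ / 2 ^ (k + 1)) = Λ / 2 ^ k := by field_simp; ring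
    simp only [h2] at h
    rw [ih] at h
    simp only [subdivData]
    rw [h, symbolProd, symbolProd, Finset.prod_range_succ]
    ring

/-! ### Piecewise linear interpolants -/

/-- The piecewise linear interpolant of the data after `k` steps of the scheme. -/
def schemePolygon (τ : ℕ → ℝ) (a : ℕ → ℝ[T;T⁻¹]) (k : ℕ) (q : ℤ → ℂ) : ℝ → ℂ :=
  polygon τ k (subdivData a q k)

theorem continuous_polygon (τ : ℕ → ℝ) (k : ℕ) (q : ℤ → ℂ) : Continuous (polygon τ k q) := by
  have key : Continuous fun u : ℝ => ((1 - Int.fract u : ℝ) : ℂ) * q ⌊u⌋ +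
      ((Int.fract u : ℝ) : ℂ) * q (⌊u⌋ + 1) := by
    rw [continuous_iff_continuousAt]
    intro u₀
    -- Here `n` is an integer nearest to `u₀`, so near `u₀` only the two cells adjacent to `n`
    -- occur; the `max`/`min` formula covers both at once.
    set n : ℤ := ⌊u₀ + 1 / 2⌋
    have h1 : (n : ℝ) ≤ u₀ + 1 / 2 := Int.floor_le _
    have h2 : u₀ + 1 / 2 < n + 1 := Int.lt_floor_add_one _
    have hcont : Continuous fun u : ℝ => q n + ((max 0 (u - n) : ℝ) : ℂ) * (q (n + 1) - q n) +
      ((min 0 (u - n) : ℝ) : ℂ) * (q n - q (n - 1)) := by fun_prop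
    refine hcont.continuousAt.congr ?_
    filter_upwards [Ioo_mem_nhds (show (n : ℝ) - 1 < u₀ by linarith)
      (show u₀ < (n : ℝ) + 1 by linarith)] with u hu
    rcases le_or_gt (n : ℝ) u with hle | hlt
    · have hf : ⌊u⌋ = n := Int.floor_eq_iff.2 ⟨hle, hu.2⟩
      have hfr : Int.fract u = u - n := by rw [Int.fract, hf]
      rw [hfr, hf, max_eq_right (by linarith), min_eq_left (by linarith)]
      push_cast
      ring
    · have hf : ⌊u⌋ = n - 1 := Int.floor_eq_iff.2
        ⟨by push_cast; linarith [hu.1], by push_cast; linarith⟩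
      have hfr : Int.fract u = u - (n - 1) := by rw [Int.fract, hf]; push_cast; ring
      rw [hfr, hf, max_eq_left (by linarith), min_eq_right (by linarith), sub_add_cancel]
      push_cast
      ring
  exact key.comp (by fun_prop : Continuous fun x : ℝ => (x - τ k) * 2 ^ k)

theorem polygon_gridPoint (τ : ℕ → ℝ) (k : ℕ) (q : ℤ → ℂ) (i : ℤ) :
    polygon τ k q (gridPoint τ k i) = q i := by
  have : (gridPoint τ k i - τ k) * 2 ^ k = i := by
    simp [gridPoint]
  simp [polygon, this]

theorem schemePolygon_add (τ : ℕ → ℝ) (a : ℕ → ℝ[T;T⁻¹]) (k : ℕ) (q q' : ℤ → ℂ) (x : ℝ) :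
    schemePolygon τ a k (q + q') x = schemePolygon τ a k q x + schemePolygon τ a k q' x := by
  simp only [schemePolygon, polygon, subdivData_add, Pi.add_apply]
  ring

theorem schemePolygon_smul (τ : ℕ → ℝ) (a : ℕ → ℝ[T;T⁻¹]) (k : ℕ) (c : ℂ) (q : ℤ → ℂ) (x : ℝ) :
    schemePolygon τ a k (c • q) x = c * schemePolygon τ a k q x := by
  simp only [schemePolygon, polygon, subdivData_smul, Pi.smul_apply, smul_eq_mul]
  ring

theorem schemePolygon_shift (τ : ℕ → ℝ) (a : ℕ → ℝ[T;T⁻¹]) (k : ℕ) (q : ℤ → ℂ) (x : ℝ) :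
    schemePolygon τ a k (fun j => q (j + 1)) x = schemePolygon τ a k q (x + 1) := by
  have h : (x + 1 - τ k) * 2 ^ k = (x - τ k) * 2 ^ k + ((2 ^ k : ℤ) : ℝ) := by push_cast; ring
  simp only [schemePolygon, polygon, h, Int.fract_add_intCast, Int.floor_add_intCast,
    subdivData_shift, mul_one]
  ring_nf

theorem continuous_schemePolygon (τ : ℕ → ℝ) (a : ℕ → ℝ[T;T⁻¹]) (k : ℕ) (x : ℝ) :
    Continuous fun q => schemePolygon τ a k q x := by
  have h := continuous_pi_iff.1 (continuous_subdivData a k)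
  unfold schemePolygon polygon
  have h1 := h ⌊(x - τ k) * 2 ^ k⌋
  have h2 := h (⌊(x - τ k) * 2 ^ k⌋ + 1)
  fun_prop

/-- If the scheme is convergent, then on `[0, 1]` all interpolants depend on the initial data in
one common finite window only. -/
theorem Convergent.exists_window {τ : ℕ → ℝ} {a : ℕ → ℝ[T;T⁻¹]} (h : Convergent τ a) :
    ∃ J : Finset ℤ, ∀ k, ∀ x ∈ Set.Icc (0 : ℝ) 1, ∀ q : ℤ → ℂ, (∀ j ∈ J, q j = 0) →
      schemePolygon τ a k q x = 0 := by
  -- Baire category: these closed sets cover the space of all data, so one of them has an interior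
  -- point. A basic neighbourhood of that point restricts only the coordinates in a finite set `J`.
  let s : ℕ → Set (ℤ → ℂ) := fun n =>
    {q | ∀ k, ∀ x ∈ Set.Icc (0 : ℝ) 1, ‖schemePolygon τ a k q x‖ ≤ n}
  have hclosed : ∀ n, IsClosed (s n) := by
    intro n
    simp only [s, Set.ofPred_forall]
    exact isClosed_iInter fun k => isClosed_iInter fun x => isClosed_iInter fun _ =>
      isClosed_le (continuous_schemePolygon τ a k x).norm continuous_const
  have hunion : ⋃ n, s n = Set.univ := by
    refine Set.eq_univ_of_forall fun q => ?_
    obtain ⟨g, hg⟩ := h.1 q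
    have hcg : Continuous g :=
      hg.continuous (Frequently.of_forall fun k => continuous_polygon τ k _)
    obtain ⟨B, hB⟩ := isCompact_Icc.exists_bound_of_continuousOn
      (hcg.continuousOn (s := Set.Icc (0 : ℝ) 1))
    have hu := (tendstoLocallyUniformlyOn_iff_tendstoUniformlyOn_of_compact isCompact_Icc).1
      (hg.tendstoLocallyUniformlyOn (s := Set.Icc (0 : ℝ) 1))
    obtain ⟨K, hK⟩ := eventually_atTop.1 (Metric.tendstoUniformlyOn_iff.1 hu 1 one_pos)
    have hb : ∀ k, ∃ C, ∀ x ∈ Set.Icc (0 : ℝ) 1, ‖schemePolygon τ a k q x‖ ≤ C := fun k =>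
      isCompact_Icc.exists_bound_of_continuousOn
        (continuous_polygon τ k (subdivData a q k)).continuousOn
    choose C hC using hb
    obtain ⟨n, hn⟩ := exists_nat_ge (|B| + 1 + ∑ k ∈ Finset.range K, |C k|)
    refine Set.mem_iUnion.2 ⟨n, fun k x hx => le_trans ?_ hn⟩
    have hsum : 0 ≤ ∑ k ∈ Finset.range K, |C k| := Finset.sum_nonneg fun _ _ => abs_nonneg _
    rcases lt_or_ge k K with hk | hk
    · have h1 := Finset.single_le_sum (f := fun k => |C k|) (fun _ _ => abs_nonneg _)
        (Finset.mem_range.2 hk)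
      have h2 := (hC k x hx).trans (le_abs_self _)
      have h3 := abs_nonneg B
      linarith
    · have h1 := hK k hk x hx
      rw [dist_eq_norm] at h1
      have h2 := hB x hx
      have h3 : ‖schemePolygon τ a k q x‖ ≤ ‖g x‖ + ‖g x - schemePolygon τ a k q x‖ := by
        have := norm_sub_le (g x) (g x - schemePolygon τ a k q x)
        rwa [sub_sub_cancel] at this
      have h4 := le_abs_self B
      have h5 : ‖g x - schemePolygon τ a k q x‖ < 1 := h1
      linarith
  obtain ⟨n, q₀, hq₀⟩ := nonempty_interior_of_iUnion_of_closed hclosed hunion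
  obtain ⟨J, u, hu, hsub⟩ := isOpen_pi_iff.1 isOpen_interior q₀ hq₀
  refine ⟨J, fun k x hx q hq => ?_⟩
  by_contra hne
  have hmem : ∀ t : ℂ, q₀ + t • q ∈ s n := fun t => interior_subset <| hsub fun j hj => by
    simpa [hq j hj] using (hu j hj).2
  -- Data vanishing on `J` can be added with any factor. This factor moves the value by `2n + 1`,
  -- whereas two values of norm at most `n` differ by at most `2n`.
  have h1 := hmem ((2 * n + 1) / schemePolygon τ a k q x) k x hx
  have h0 := hmem 0 k x hx
  rw [zero_smul, add_zero] at h0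
  rw [schemePolygon_add, schemePolygon_smul, div_mul_cancel₀ _ hne] at h1
  have h2 := norm_sub_le (schemePolygon τ a k q₀ x + (2 * n + 1)) (schemePolygon τ a k q₀ x)
  rw [add_sub_cancel_left] at h2
  have h3 : ‖(2 * n + 1 : ℂ)‖ = 2 * n + 1 := by
    have : (2 * n + 1 : ℂ) = ((2 * n + 1 : ℝ) : ℂ) := by push_cast; ring
    rw [this, Complex.norm_real, Real.norm_of_nonneg (by positivity)]
  rw [h3] at h2
  linarith

/-! ### Shift-equivariant local operators -/

/-- Linear operators from sequences to continuous functions that commute with integer shifts and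
whose values on `[0, 1]` depend on the entries in the window `J` only. -/
structure IsLocalOperator (J : Finset ℤ) (Q : (ℤ → ℂ) → ℝ → ℂ) : Prop where
  add : ∀ q q' x, Q (q + q') x = Q q x + Q q' x
  smul : ∀ (c : ℂ) q x, Q (c • q) x = c * Q q x
  shift : ∀ q x, Q (fun j => q (j + 1)) x = Q q (x + 1)
  continuous : ∀ q, Continuous (Q q)
  window : ∀ x ∈ Set.Icc (0 : ℝ) 1, ∀ q : ℤ → ℂ, (∀ j ∈ J, q j = 0) → Q q x = 0

theorem IsLocalOperator.sum {J : Finset ℤ} {Q : (ℤ → ℂ) → ℝ → ℂ} (hQ : IsLocalOperator J Q)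
    {ι : Type*} (s : Finset ι) (q : ι → ℤ → ℂ) (x : ℝ) :
    Q (∑ i ∈ s, q i) x = ∑ i ∈ s, Q (q i) x := by
  classical
  induction s using Finset.induction_on with
  | empty => simpa using hQ.smul 0 0 x
  | insert i s hi ih => rw [Finset.sum_insert hi, Finset.sum_insert hi, hQ.add, ih]

theorem IsLocalOperator.eq_sum {J : Finset ℤ} {Q : (ℤ → ℂ) → ℝ → ℂ} (hQ : IsLocalOperator J Q)
    {x : ℝ} (hx : x ∈ Set.Icc (0 : ℝ) 1) (q : ℤ → ℂ) :
    Q q x = ∑ j ∈ J, q j * Q (Pi.single j 1) x := by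
  have h0 : Q (q + (-1 : ℂ) • ∑ j ∈ J, q j • Pi.single j (1 : ℂ)) x = 0 := by
    refine hQ.window x hx _ fun i hi => ?_
    simp [Finset.sum_apply, Pi.single_apply, hi]
  rw [hQ.add, hQ.smul, hQ.sum] at h0
  simp only [hQ.smul] at h0
  linear_combination h0

theorem IsLimitFunction.tendsto {τ : ℕ → ℝ} {a : ℕ → ℝ[T;T⁻¹]} {q : ℤ → ℂ} {g : ℝ → ℂ}
    (h : IsLimitFunction τ a q g) (x : ℝ) :
    Tendsto (fun k => schemePolygon τ a k q x) atTop (𝓝 (g x)) :=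
  (TendstoLocallyUniformly.tendstoLocallyUniformlyOn (s := Set.univ) h).tendsto_at (Set.mem_univ x)

theorem IsLimitFunction.unique {τ : ℕ → ℝ} {a : ℕ → ℝ[T;T⁻¹]} {q : ℤ → ℂ} {g g' : ℝ → ℂ}
    (h : IsLimitFunction τ a q g) (h' : IsLimitFunction τ a q g') : g = g' :=
  funext fun x => tendsto_nhds_unique (h.tendsto x) (h'.tendsto x)

theorem isLocalOperator_schemePolygon {τ : ℕ → ℝ} {a : ℕ → ℝ[T;T⁻¹]} {J : Finset ℤ} {k : ℕ}
    (hJ : ∀ x ∈ Set.Icc (0 : ℝ) 1, ∀ q : ℤ → ℂ, (∀ j ∈ J, q j = 0) →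
      schemePolygon τ a k q x = 0) :
    IsLocalOperator J (schemePolygon τ a k) where
  add := schemePolygon_add τ a k
  smul := schemePolygon_smul τ a k
  shift := schemePolygon_shift τ a k
  continuous _ := continuous_polygon τ k _
  window := hJ

theorem isLocalOperator_limit {τ : ℕ → ℝ} {a : ℕ → ℝ[T;T⁻¹]} {J : Finset ℤ}
    (hJ : ∀ k, ∀ x ∈ Set.Icc (0 : ℝ) 1, ∀ q : ℤ → ℂ, (∀ j ∈ J, q j = 0) →
      schemePolygon τ a k q x = 0)
    {Q : (ℤ → ℂ) → ℝ → ℂ} (hQ : ∀ q, IsLimitFunction τ a q (Q q)) :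
    IsLocalOperator J Q where
  add q q' x := tendsto_nhds_unique ((hQ (q + q')).tendsto x) <| by
    simpa only [schemePolygon_add] using ((hQ q).tendsto x).add ((hQ q').tendsto x)
  smul c q x := tendsto_nhds_unique ((hQ (c • q)).tendsto x) <| by
    simpa only [schemePolygon_smul] using ((hQ q).tendsto x).const_mul c
  shift q x := tendsto_nhds_unique ((hQ _).tendsto x) <| by
    simpa only [schemePolygon_shift] using (hQ q).tendsto (x + 1)
  continuous q := (hQ q).continuous (Frequently.of_forall fun k => continuous_polygon τ k _)
  window x hx q hq := tendsto_nhds_unique ((hQ q).tendsto x) <| by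
    simp only [fun k => hJ k x hx q hq, tendsto_const_nhds]

/-! ### Exponential moments of a local operator -/

/-- The samples at `y + j`, `j ∈ ℤ`, of the function `x ↦ x ^ r * e^{Λ x}`. -/
def expData (r : ℕ) (Λ : ℂ) (y : ℝ) : ℤ → ℂ :=
  fun j => ((y + j : ℝ) : ℂ) ^ r * Complex.exp (Λ * ((y + j : ℝ) : ℂ))

theorem expData_shift (r : ℕ) (Λ : ℂ) (y : ℝ) :
    (fun j => expData r Λ y (j + 1)) = expData r Λ (y + 1) := by
  ext j
  have : y + ((j + 1 : ℤ) : ℝ) = y + 1 + j := by push_cast; ring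
  simp only [expData, this]

theorem expData_add (r : ℕ) (Λ : ℂ) (y y' : ℝ) :
    expData r Λ (y + y') = ∑ s ∈ Finset.range (r + 1),
      ((y' : ℂ) ^ (r - s) * (r.choose s) * Complex.exp (Λ * y')) • expData s Λ y := by
  ext j
  have h : ((y + y' + j : ℝ) : ℂ) = ((y + j : ℝ) : ℂ) + (y' : ℂ) := by push_cast; ring
  simp only [expData, Finset.sum_apply, Pi.smul_apply, smul_eq_mul]
  rw [h, add_pow, mul_add, Complex.exp_add, Finset.sum_mul]
  exact Finset.sum_congr rfl fun s _ => by ring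

theorem expData_add_two_pi (r : ℕ) (Λ : ℂ) (m : ℤ) (y : ℝ) :
    expData r (Λ + 2 * Real.pi * Complex.I * m) y =
      Complex.exp (2 * Real.pi * Complex.I * m * y) • expData r Λ y := by
  ext j
  simp only [expData, Pi.smul_apply, smul_eq_mul]
  rw [mul_left_comm, ← Complex.exp_add]
  congr 1
  have : (Λ + 2 * Real.pi * Complex.I * m) * ((y + j : ℝ) : ℂ) =
      2 * Real.pi * Complex.I * m * y + Λ * ((y + j : ℝ) : ℂ) +
        ((m * j : ℤ) : ℂ) * (2 * Real.pi * Complex.I) := by push_cast; ring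
  rw [this, Complex.exp_periodic.int_mul]

/-- The function `x ↦ Q ((c + · - x) ^ r * e^{Λ (c + · - x)}) x`. -/
def twisted (Q : (ℤ → ℂ) → ℝ → ℂ) (c : ℝ) (r : ℕ) (Λ : ℂ) (x : ℝ) : ℂ :=
  Q (expData r Λ (c - x)) x

/-- The integral of `twisted Q c r Λ` over a period. -/
def moment (Q : (ℤ → ℂ) → ℝ → ℂ) (c : ℝ) (r : ℕ) (Λ : ℂ) : ℂ :=
  ∫ x in (0 : ℝ)..1, twisted Q c r Λ x

section
variable {J : Finset ℤ} {Q : (ℤ → ℂ) → ℝ → ℂ} (hQ : IsLocalOperator J Q)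
include hQ

theorem IsLocalOperator.map_expData_add (r : ℕ) (Λ : ℂ) (y y' x : ℝ) :
    Q (expData r Λ (y + y')) x = ∑ s ∈ Finset.range (r + 1),
      ((y' : ℂ) ^ (r - s) * (r.choose s) * Complex.exp (Λ * y')) * Q (expData s Λ y) x := by
  rw [expData_add, hQ.sum]
  simp only [hQ.smul]

/-- Moving `x` by 1 moves the evaluation point forward and the sampled function back by the same
integer; shift-equivariance cancels the two. -/
theorem IsLocalOperator.twisted_periodic (c : ℝ) (r : ℕ) (Λ : ℂ) :
    Function.Periodic (twisted Q c r Λ) 1 := by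
  intro x
  rw [twisted, ← hQ.shift, expData_shift, twisted]
  congr 2
  ring

theorem IsLocalOperator.continuous_twisted (c : ℝ) (r : ℕ) (Λ : ℂ) :
    Continuous (twisted Q c r Λ) := by
  have : twisted Q c r Λ = fun x => ∑ s ∈ Finset.range (r + 1),
      (((-x : ℝ) : ℂ) ^ (r - s) * (r.choose s) * Complex.exp (Λ * ((-x : ℝ) : ℂ))) *
        Q (expData s Λ c) x := by
    ext x
    rw [twisted, sub_eq_add_neg, hQ.map_expData_add]
  rw [this]
  refine continuous_finsetSum _ fun s _ => ?_
  have := hQ.continuous (expData s Λ c)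
  fun_prop

theorem IsLocalOperator.twisted_add_two_pi (c : ℝ) (r : ℕ) (Λ : ℂ) (m : ℤ) (x : ℝ) :
    twisted Q c r (Λ + 2 * Real.pi * Complex.I * m) x =
      Complex.exp (2 * Real.pi * Complex.I * m * (c - x)) * twisted Q c r Λ x := by
  rw [twisted, expData_add_two_pi, hQ.smul, twisted]
  push_cast
  rfl

/-- On a translate of `ℤ`, adding `2πi m` to the exponent is multiplication by a constant. Moments
at `Λ + 2πi m` are therefore Fourier coefficients of one periodic function. -/
theorem IsLocalOperator.moment_add_two_pi (c : ℝ) (r : ℕ) (Λ : ℂ) (m : ℤ) :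
    moment Q c r (Λ + 2 * Real.pi * Complex.I * m) =
      Complex.exp (2 * Real.pi * Complex.I * m * c) *
        ∫ x in (0 : ℝ)..1, Complex.exp (-(2 * Real.pi * Complex.I * m * x)) * twisted Q c r Λ x := by
  rw [moment, ← intervalIntegral.integral_const_mul]
  refine intervalIntegral.integral_congr fun x _ => ?_
  rw [hQ.twisted_add_two_pi, ← mul_assoc, ← Complex.exp_add]
  congr 2
  ring

omit hQ in
theorem continuous_expData (r : ℕ) (Λ : ℂ) (c : ℝ) (j : ℤ) :
    Continuous fun x : ℝ => expData r Λ (c - x) j := by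
  unfold expData
  fun_prop

theorem IsLocalOperator.moment_eq_sum (c : ℝ) (r : ℕ) (Λ : ℂ) :
    moment Q c r Λ = ∑ j ∈ J, ∫ x in (0 : ℝ)..1, expData r Λ (c - x) j * Q (Pi.single j 1) x := by
  rw [moment, ← intervalIntegral.integral_finsetSum]
  · refine intervalIntegral.integral_congr fun x hx => ?_
    rw [Set.uIcc_of_le zero_le_one] at hx
    exact hQ.eq_sum hx _
  · intro j _
    exact ((continuous_expData r Λ c j).mul (hQ.continuous _)).intervalIntegrable _ _

omit hQ in
theorem hasDerivAt_integral_pow_mul_exp {f : ℝ → ℂ} (hf : Continuous f) {b : ℝ → ℝ}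
    (hb : Continuous b) (r : ℕ) (Λ : ℂ) :
    HasDerivAt (fun Λ : ℂ => ∫ x in (0 : ℝ)..1, (b x : ℂ) ^ r * Complex.exp (Λ * b x) * f x)
      (∫ x in (0 : ℝ)..1, (b x : ℂ) ^ (r + 1) * Complex.exp (Λ * b x) * f x) Λ := by
  refine (intervalIntegral.hasDerivAt_integral_of_dominated_loc_of_deriv_le
    (F := fun (Λ : ℂ) x => (b x : ℂ) ^ r * Complex.exp (Λ * b x) * f x)
    (F' := fun (Λ : ℂ) x => (b x : ℂ) ^ (r + 1) * Complex.exp (Λ * b x) * f x)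
    (s := Metric.ball Λ 1)
    (bound := fun x => |b x| ^ (r + 1) * Real.exp ((‖Λ‖ + 1) * |b x|) * ‖f x‖)
    (Metric.ball_mem_nhds Λ one_pos) ?_ ?_ ?_ ?_ ?_ ?_).2
  · exact Eventually.of_forall fun Λ => (by fun_prop : Continuous fun x =>
      (b x : ℂ) ^ r * Complex.exp (Λ * b x) * f x).aestronglyMeasurable
  · exact (by fun_prop : Continuous fun x =>
      (b x : ℂ) ^ r * Complex.exp (Λ * b x) * f x).intervalIntegrable _ _
  · exact (by fun_prop : Continuous fun x =>
      (b x : ℂ) ^ (r + 1) * Complex.exp (Λ * b x) * f x).aestronglyMeasurable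
  · refine Eventually.of_forall fun x _ z hz => ?_
    rw [norm_mul, norm_mul, norm_pow, Complex.norm_real, Real.norm_eq_abs, Complex.norm_exp]
    gcongr
    refine (Complex.re_le_norm _).trans ?_
    rw [norm_mul, Complex.norm_real, Real.norm_eq_abs]
    gcongr
    have := norm_sub_norm_le z Λ
    rw [Metric.mem_ball, dist_eq_norm] at hz
    linarith
  · exact (by fun_prop : Continuous fun x =>
      |b x| ^ (r + 1) * Real.exp ((‖Λ‖ + 1) * |b x|) * ‖f x‖).intervalIntegrable _ _
  · refine Eventually.of_forall fun x _ z _ => ?_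
    have h := (((hasDerivAt_id z).mul_const (b x : ℂ)).cexp.const_mul ((b x : ℂ) ^ r)).mul_const (f x)
    convert! h using 1
    simp only [id]
    ring

/-- Differentiating `e^{Λ(c-x+j)}` in `Λ` brings down the factor `c - x + j`, which raises the power
`r` by one. -/
theorem IsLocalOperator.hasDerivAt_moment (c : ℝ) (r : ℕ) (Λ : ℂ) :
    HasDerivAt (moment Q c r) (moment Q c (r + 1) Λ) Λ := by
  have : moment Q c r = fun Λ => ∑ j ∈ J,
      ∫ x in (0 : ℝ)..1, expData r Λ (c - x) j * Q (Pi.single j 1) x :=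
    funext (hQ.moment_eq_sum c r)
  rw [this, hQ.moment_eq_sum]
  refine HasDerivAt.fun_sum fun j _ => ?_
  exact hasDerivAt_integral_pow_mul_exp (hQ.continuous _) (b := fun x => c - x + j)
    (by fun_prop) r Λ

theorem IsLocalOperator.differentiable_moment (c : ℝ) (r : ℕ) :
    Differentiable ℂ (moment Q c r) :=
  fun Λ => (hQ.hasDerivAt_moment c r Λ).differentiableAt

theorem IsLocalOperator.iteratedDeriv_moment (c : ℝ) (r : ℕ) :
    iteratedDeriv r (moment Q c 0) = moment Q c r := by
  induction r with
  | zero => simp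
  | succ r ih =>
    rw [iteratedDeriv_succ, ih]
    exact funext fun Λ => (hQ.hasDerivAt_moment c r Λ).deriv

theorem IsLocalOperator.le_analyticOrderAt_moment_iff (c : ℝ) (μ : ℕ) (Λ : ℂ) :
    μ ≤ analyticOrderAt (moment Q c 0) Λ ↔ ∀ r < μ, moment Q c r Λ = 0 := by
  rw [natCast_le_analyticOrderAt_iff_iteratedDeriv_eq_zero
    ((hQ.differentiable_moment c 0).analyticAt Λ)]
  simp only [hQ.iteratedDeriv_moment]

omit hQ in
theorem norm_expData_le {r : ℕ} {Λ : ℂ} {R c x : ℝ} (hΛ : ‖Λ‖ ≤ R) (hx : x ∈ Set.Icc (0 : ℝ) 1)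
    (j : ℤ) :
    ‖expData r Λ (c - x) j‖ ≤ (|c| + 1 + |(j : ℝ)|) ^ r * Real.exp (R * (|c| + 1 + |(j : ℝ)|)) := by
  have hR : 0 ≤ R := (norm_nonneg _).trans hΛ
  have hb : |c - x + j| ≤ |c| + 1 + |(j : ℝ)| := by
    refine (abs_add_le _ _).trans ?_
    gcongr
    refine (abs_sub _ _).trans ?_
    gcongr
    rw [abs_of_nonneg hx.1]
    exact hx.2
  rw [expData, norm_mul, norm_pow, Complex.norm_real, Real.norm_eq_abs, Complex.norm_exp]
  gcongr
  refine (Complex.re_le_norm _).trans ?_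
  rw [norm_mul, Complex.norm_real, Real.norm_eq_abs]
  gcongr

/-- Because the window `J` is common to all `k`, only the images of finitely many unit impulses need
to converge. -/
theorem tendstoUniformlyOn_moment {P : ℕ → (ℤ → ℂ) → ℝ → ℂ}
    (hP : ∀ k, IsLocalOperator J (P k))
    (hlim : ∀ q, TendstoLocallyUniformly (fun k => P k q) (Q q) atTop) (c : ℝ) (r : ℕ) (R : ℝ) :
    TendstoUniformlyOn (fun k => moment (P k) c r) (moment Q c r) atTop (Metric.closedBall 0 R) := by
  rw [Metric.tendstoUniformlyOn_iff]
  intro ε hε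
  set M : ℤ → ℝ := fun j => (|c| + 1 + |(j : ℝ)|) ^ r * Real.exp (R * (|c| + 1 + |(j : ℝ)|))
  have hM : ∀ j, 0 ≤ M j := fun j => by positivity
  have hS : 0 < ∑ j ∈ J, M j + 1 := by
    have := Finset.sum_nonneg fun j (_ : j ∈ J) => hM j
    linarith
  have hev : ∀ᶠ k in atTop, ∀ j ∈ J, ∀ x ∈ Set.Icc (0 : ℝ) 1,
      dist (Q (Pi.single j 1) x) (P k (Pi.single j 1) x) < ε / (∑ j ∈ J, M j + 1) := by
    rw [Filter.eventually_all_finset]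
    intro j _
    have hu := (tendstoLocallyUniformlyOn_iff_tendstoUniformlyOn_of_compact isCompact_Icc).1
      ((hlim (Pi.single j 1)).tendstoLocallyUniformlyOn (s := Set.Icc (0 : ℝ) 1))
    exact Metric.tendstoUniformlyOn_iff.1 hu _ (by positivity)
  filter_upwards [hev] with k hk Λ hΛ
  rw [mem_closedBall_zero_iff] at hΛ
  rw [dist_eq_norm, hQ.moment_eq_sum, (hP k).moment_eq_sum, ← Finset.sum_sub_distrib]
  have hint : ∀ {Q' : (ℤ → ℂ) → ℝ → ℂ}, IsLocalOperator J Q' → ∀ j : ℤ, IntervalIntegrable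
      (fun x => expData r Λ (c - x) j * Q' (Pi.single j 1) x) MeasureTheory.volume 0 1 :=
    fun h j => ((continuous_expData r Λ c j).mul (h.continuous _)).intervalIntegrable _ _
  have hterm : ∀ j ∈ J, ‖(∫ x in (0 : ℝ)..1, expData r Λ (c - x) j * Q (Pi.single j 1) x) -
      ∫ x in (0 : ℝ)..1, expData r Λ (c - x) j * P k (Pi.single j 1) x‖ ≤
      M j * (ε / (∑ j ∈ J, M j + 1)) := by
    intro j hj
    rw [← intervalIntegral.integral_sub (hint hQ j) (hint (hP k) j)]
    have := intervalIntegral.norm_integral_le_of_norm_le_const (a := (0 : ℝ)) (b := 1)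
      (f := fun x => expData r Λ (c - x) j * Q (Pi.single j 1) x -
        expData r Λ (c - x) j * P k (Pi.single j 1) x)
      (C := M j * (ε / (∑ j ∈ J, M j + 1))) fun x hx => by
        rw [Set.uIoc_of_le zero_le_one] at hx
        have hx' := Set.Ioc_subset_Icc_self hx
        rw [← mul_sub, norm_mul, ← dist_eq_norm]
        exact mul_le_mul (norm_expData_le hΛ hx' j) (hk j hj x hx').le dist_nonneg (hM j)
    simpa using this
  calc _ ≤ ∑ j ∈ J, M j * (ε / (∑ j ∈ J, M j + 1)) :=
        (norm_sum_le _ _).trans (Finset.sum_le_sum hterm)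
    _ = (∑ j ∈ J, M j) * (ε / (∑ j ∈ J, M j + 1)) := by rw [Finset.sum_mul]
    _ < (∑ j ∈ J, M j + 1) * (ε / (∑ j ∈ J, M j + 1)) := by gcongr; linarith
    _ = ε := by field_simp

end

/-! ### Fourier coefficients -/

/-- With only the zeroth coefficient left, the Fourier series is trivially summable and hence
represents the continuous function pointwise. -/
theorem eq_integral_of_fourier_coeff_eq_zero {h : ℝ → ℂ} (hc : Continuous h)
    (hp : Function.Periodic h 1)
    (h0 : ∀ m : ℤ, m ≠ 0 →
      ∫ x in (0 : ℝ)..1, Complex.exp (-(2 * Real.pi * Complex.I * m * x)) * h x = 0) (x : ℝ) :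
    h x = ∫ y in (0 : ℝ)..1, h y := by
  have : Fact ((0 : ℝ) < 1) := ⟨one_pos⟩
  let f : C(AddCircle (1 : ℝ), ℂ) := ⟨hp.lift, continuous_coinduced_dom.2 hc⟩
  have hf : ∀ y : ℝ, f (y : AddCircle (1 : ℝ)) = h y := fun y => hp.lift_coe y
  have hcoef : ∀ n : ℤ, fourierCoeff f n =
      ∫ y in (0 : ℝ)..1, Complex.exp (-(2 * Real.pi * Complex.I * n * y)) * h y := by
    intro n
    rw [fourierCoeff_eq_intervalIntegral f n 0]
    simp only [zero_add, div_one, one_smul, smul_eq_mul, hf, fourier_coe_apply]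
    refine intervalIntegral.integral_congr fun y _ => ?_
    congr 2
    push_cast
    ring
  have hz : ∀ n : ℤ, n ≠ 0 → fourierCoeff f n = 0 := fun n hn => by rw [hcoef, h0 n hn]
  have hs : Summable (fourierCoeff f) :=
    summable_of_ne_finset_zero (s := {0}) fun n hn => hz n (by simpa using hn)
  have h1 := has_pointwise_sum_fourier_series_of_summable hs (x : AddCircle (1 : ℝ))
  have h2 := hasSum_single (f := fun n : ℤ => fourierCoeff f n • fourier n (x : AddCircle (1 : ℝ)))
    0 fun n hn => by rw [hz n hn, zero_smul]
  have h3 := h1.unique h2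
  rw [hf, hcoef] at h3
  simpa using h3

/-! ### Moments of the piecewise linear interpolants -/

/-- The integral of `e^{-s x}` against the hat function `max 0 (1 - |x|)`. -/
def hatTransform (s : ℂ) : ℂ :=
  (∫ t in (0 : ℝ)..1, ((1 - t : ℝ) : ℂ) * Complex.exp (-(s * t))) +
    ∫ t in (0 : ℝ)..1, (t : ℂ) * Complex.exp (s * ((1 - t : ℝ) : ℂ))

theorem differentiable_hatTransform : Differentiable ℂ hatTransform := by
  intro s
  have h1 := hasDerivAt_integral_pow_mul_exp (f := fun t : ℝ => ((1 - t : ℝ) : ℂ))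
    (b := fun t => -t) (by fun_prop) (by fun_prop) 0 s
  have h2 := hasDerivAt_integral_pow_mul_exp (f := fun t : ℝ => (t : ℂ))
    (b := fun t => 1 - t) (by fun_prop) (by fun_prop) 0 s
  have h : hatTransform = fun s : ℂ =>
      (∫ t in (0 : ℝ)..1, ((-t : ℝ) : ℂ) ^ 0 * Complex.exp (s * (-t : ℝ)) * ((1 - t : ℝ) : ℂ)) +
      ∫ t in (0 : ℝ)..1, ((1 - t : ℝ) : ℂ) ^ 0 * Complex.exp (s * (1 - t : ℝ)) * (t : ℂ) := by
    ext s
    unfold hatTransform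
    congr 1
    all_goals
      refine intervalIntegral.integral_congr fun t _ => ?_
      simp [mul_comm]
  rw [h]
  exact (h1.add h2).differentiableAt

theorem hatTransform_zero : hatTransform 0 = 1 := by
  unfold hatTransform
  simp only [zero_mul, neg_zero, Complex.exp_zero, mul_one]
  rw [intervalIntegral.integral_ofReal, intervalIntegral.integral_ofReal, ← Complex.ofReal_add]
  have h1 : ∫ t in (0 : ℝ)..1, (1 - t) = 1 / 2 := by
    rw [intervalIntegral.integral_sub (by simp) (by simp)]
    simp; norm_num
  rw [h1, integral_id]
  norm_num

/-- `Λ / 2^k` tends to 0 uniformly on the disc, and the transform is continuous with value 1 at 0.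
-/
theorem eventually_hatTransform_ne_zero (R : ℝ) :
    ∀ᶠ k : ℕ in atTop, ∀ Λ ∈ Metric.closedBall (0 : ℂ) R, hatTransform (Λ / 2 ^ k) ≠ 0 := by
  have hc := differentiable_hatTransform.continuous.continuousAt (x := 0)
  have hne : ∀ᶠ s in 𝓝 (0 : ℂ), hatTransform s ≠ 0 :=
    hc.eventually_ne (by rw [hatTransform_zero]; exact one_ne_zero)
  obtain ⟨ε, hε, hball⟩ := Metric.eventually_nhds_iff_ball.1 hne
  have hlim : Tendsto (fun k : ℕ => R * (1 / 2 : ℝ) ^ k) atTop (𝓝 0) := by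
    simpa using (tendsto_pow_atTop_nhds_zero_of_lt_one (r := (1 / 2 : ℝ)) (by norm_num)
      (by norm_num)).const_mul R
  filter_upwards [hlim.eventually_lt_const hε] with k hk Λ hΛ
  refine hball _ ?_
  rw [mem_closedBall_zero_iff] at hΛ
  rw [mem_ball_zero_iff, norm_div, norm_pow, Complex.norm_ofNat]
  refine lt_of_le_of_lt ?_ hk
  rw [one_div, inv_pow, div_eq_mul_inv]
  gcongr

theorem polygon_add_div (τ : ℕ → ℝ) (k : ℕ) (q : ℤ → ℂ) (i : ℤ) {t : ℝ}
    (ht : t ∈ Set.Icc (0 : ℝ) 1) :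
    polygon τ k q (τ k + (i + t) / 2 ^ k) = ((1 - t : ℝ) : ℂ) * q i + (t : ℂ) * q (i + 1) := by
  have hu : (τ k + (i + t) / 2 ^ k - τ k) * 2 ^ k = i + t := by
    rw [add_sub_cancel_left]; field_simp
  rcases ht.2.lt_or_eq with h1 | rfl
  · have hf : ⌊(i : ℝ) + t⌋ = i := Int.floor_eq_iff.2 ⟨by linarith [ht.1], by linarith⟩
    have hfr : Int.fract ((i : ℝ) + t) = t := by rw [Int.fract, hf]; ring
    simp only [polygon, hu, hf, hfr]
  · have h := polygon_gridPoint τ k q (i + 1)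
    rw [gridPoint] at h
    push_cast at h
    rw [h]
    simp

/-- After moving the period to start at `τ k`, it splits into `2^k` cells. Each cell contributes its
two endpoint values weighted by the two halves of the hat function. The weighted data are
`2^k`-periodic, so both endpoint sums agree and `sum_subdivData_exp` evaluates them. The parameters
`τ k` enter only through a zero-free factor, so they need not converge. -/
theorem moment_schemePolygon (τ : ℕ → ℝ) (a : ℕ → ℝ[T;T⁻¹]) (c : ℝ) (k : ℕ) {J : Finset ℤ}
    (hP : IsLocalOperator J (schemePolygon τ a k)) (Λ : ℂ) :
    moment (schemePolygon τ a k) c 0 Λ =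
      Complex.exp (Λ * (c - τ k)) * hatTransform (Λ / 2 ^ k) * symbolProd a k Λ := by
  set f := twisted (schemePolygon τ a k) c 0 Λ with hfdef
  set d : ℤ → ℂ := subdivData a (fun j => Complex.exp (Λ * (c + j))) k with hd
  have hf : ∀ x, f x = Complex.exp (-(Λ * x)) * polygon τ k d x := by
    intro x
    have h1 : expData 0 Λ (c - x) =
        Complex.exp (-(Λ * x)) • fun j : ℤ => Complex.exp (Λ * (c + j)) := by
      ext j
      simp only [expData, pow_zero, one_mul, Pi.smul_apply, smul_eq_mul, ← Complex.exp_add]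
      congr 1; push_cast; ring
    rw [hfdef, twisted, h1, schemePolygon_smul, schemePolygon]
  have hcont : Continuous f := hP.continuous_twisted c 0 Λ
  have hshift : moment (schemePolygon τ a k) c 0 Λ = ∫ y in (0 : ℝ)..1, f (τ k + y) := by
    rw [moment, ← hfdef, intervalIntegral.integral_comp_add_left, add_zero]
    have := (hP.twisted_periodic c 0 Λ).intervalIntegral_add_eq 0 (τ k)
    rw [zero_add] at this
    exact this
  have hsplit : ∫ y in (0 : ℝ)..1, f (τ k + y) = ∑ i ∈ Finset.range (2 ^ k),
      ∫ y in ((i : ℝ) / 2 ^ k)..(((i + 1 : ℕ) : ℝ) / 2 ^ k), f (τ k + y) := by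
    rw [intervalIntegral.sum_integral_adjacent_intervals
      (a := fun i : ℕ => (i : ℝ) / 2 ^ k) (n := 2 ^ k)]
    · simp
    · intro i _
      exact (by fun_prop : Continuous fun y => f (τ k + y)).intervalIntegrable _ _
  set u : ℤ → ℂ := fun i => d i * Complex.exp (-(Λ / 2 ^ k * i)) with hu
  have hcell : ∀ i : ℕ, ∫ y in ((i : ℝ) / 2 ^ k)..(((i + 1 : ℕ) : ℝ) / 2 ^ k), f (τ k + y) =
      Complex.exp (-(Λ * τ k)) / 2 ^ k *
        (u i * (∫ t in (0 : ℝ)..1, ((1 - t : ℝ) : ℂ) * Complex.exp (-(Λ / 2 ^ k * t))) +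
         u (i + 1) * ∫ t in (0 : ℝ)..1, (t : ℂ) * Complex.exp (Λ / 2 ^ k * ((1 - t : ℝ) : ℂ))) := by
    intro i
    have hsub := intervalIntegral.integral_comp_add_mul (a := 0) (b := 1) (fun y => f (τ k + y))
      (c := 1 / 2 ^ k) (by positivity) ((i : ℝ) / 2 ^ k)
    have e1 : (i : ℝ) / 2 ^ k + 1 / 2 ^ k * 0 = i / 2 ^ k := by ring
    have e2 : (i : ℝ) / 2 ^ k + 1 / 2 ^ k * 1 = ((i + 1 : ℕ) : ℝ) / 2 ^ k := by push_cast; ring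
    rw [e1, e2, inv_div, div_one] at hsub
    have hsub' : ∫ y in ((i : ℝ) / 2 ^ k)..(((i + 1 : ℕ) : ℝ) / 2 ^ k), f (τ k + y) =
        (1 / 2 ^ k : ℂ) * ∫ t in (0 : ℝ)..1, f (τ k + ((i : ℝ) / 2 ^ k + 1 / 2 ^ k * t)) := by
      rw [hsub, Complex.real_smul, ← mul_assoc]
      push_cast
      rw [one_div_mul_cancel (pow_ne_zero _ two_ne_zero), one_mul]
    have c1 : Continuous fun t : ℝ =>
        u i * (((1 - t : ℝ) : ℂ) * Complex.exp (-(Λ / 2 ^ k * t))) := by fun_prop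
    have c2 : Continuous fun t : ℝ =>
        u (i + 1) * ((t : ℂ) * Complex.exp (Λ / 2 ^ k * ((1 - t : ℝ) : ℂ))) := by fun_prop
    rw [hsub', ← intervalIntegral.integral_const_mul, ← intervalIntegral.integral_const_mul,
      ← intervalIntegral.integral_const_mul,
      ← intervalIntegral.integral_add (c1.intervalIntegrable _ _) (c2.intervalIntegrable _ _),
      ← intervalIntegral.integral_const_mul]
    refine intervalIntegral.integral_congr fun t ht => ?_
    rw [Set.uIcc_of_le zero_le_one] at ht
    have e3 : τ k + ((i : ℝ) / 2 ^ k + 1 / 2 ^ k * t) = τ k + (((i : ℤ) : ℝ) + t) / 2 ^ k := by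
      push_cast; ring
    simp only [hu]
    rw [e3, hf, polygon_add_div τ k d i ht]
    have e4 : Complex.exp (-(Λ * ((τ k + (((i : ℤ) : ℝ) + t) / 2 ^ k : ℝ) : ℂ))) =
        Complex.exp (-(Λ * τ k)) * (Complex.exp (-(Λ / 2 ^ k * i)) *
          Complex.exp (-(Λ / 2 ^ k * t))) := by
      rw [← Complex.exp_add, ← Complex.exp_add]; congr 1; push_cast; ring
    have e5 : Complex.exp (-(Λ / 2 ^ k * ((i + 1 : ℤ) : ℂ))) *
        Complex.exp (Λ / 2 ^ k * ((1 - t : ℝ) : ℂ)) =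
        Complex.exp (-(Λ / 2 ^ k * i)) * Complex.exp (-(Λ / 2 ^ k * t)) := by
      rw [← Complex.exp_add, ← Complex.exp_add]; congr 1; push_cast; ring
    rw [e4]
    push_cast at e5 ⊢
    linear_combination (-(1 / 2 ^ k) * Complex.exp (-(Λ * τ k)) * t * d (i + 1)) * e5
  have hper : ∀ j, u (j + (2 ^ k : ℕ)) = u j := by
    intro j
    have h1 := subdivData_exp_add a Λ c k j
    simp only [hu, hd]
    push_cast
    rw [h1, mul_right_comm, ← Complex.exp_add, mul_comm]
    congr 2
    field_simp
    ring
  have hsum : ∑ i ∈ Finset.range (2 ^ k), u i = 2 ^ k * (Complex.exp (Λ * c) * symbolProd a k Λ) :=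
    sum_subdivData_exp a Λ c k
  have hsum' : ∑ i ∈ Finset.range (2 ^ k), u (i + 1) = ∑ i ∈ Finset.range (2 ^ k), u i :=
    sum_range_add_of_periodic hper 1
  rw [hshift, hsplit, Finset.sum_congr rfl fun i _ => hcell i, ← Finset.mul_sum,
    Finset.sum_add_distrib, ← Finset.sum_mul, ← Finset.sum_mul, hsum', ← mul_add, ← hatTransform,
    hsum, mul_sub, Complex.exp_sub, Complex.exp_neg]
  field_simp

/-! ### Zeros of limits of products -/

/-- If `f` had smaller order `ν`, dividing the bound by `‖z - z₀‖ ^ ν` and letting `z → z₀` would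
make the leading factor of `f` vanish. -/
theorem le_analyticOrderAt_of_norm_le {f g : ℂ → ℂ} {z₀ : ℂ} (hf : AnalyticAt ℂ f z₀)
    (hg : AnalyticAt ℂ g z₀) {C : ℝ} (hfg : ∀ᶠ z in 𝓝 z₀, ‖f z‖ ≤ C * ‖g z‖) {μ : ℕ}
    (hμ : μ ≤ analyticOrderAt g z₀) : μ ≤ analyticOrderAt f z₀ := by
  by_contra hlt
  rw [not_le] at hlt
  obtain ⟨ν, hν⟩ := ENat.ne_top_iff_exists.1 hlt.ne_top
  rw [← hν, Nat.cast_lt] at hlt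
  obtain ⟨h, hh, hne, hfh⟩ := hf.analyticOrderAt_eq_natCast.1 hν.symm
  obtain ⟨g₁, hg₁, hgg⟩ := (natCast_le_analyticOrderAt hg).1 hμ
  have hle : ∀ᶠ z in 𝓝[≠] z₀, ‖h z‖ ≤ C * (‖z - z₀‖ ^ (μ - ν) * ‖g₁ z‖) := by
    have hall := hfg.and (hfh.and hgg)
    filter_upwards [hall.filter_mono nhdsWithin_le_nhds, self_mem_nhdsWithin] with z hz hzne
    obtain ⟨h1, h2, h3⟩ := hz
    have hpos : 0 < ‖z - z₀‖ ^ ν := pow_pos (norm_pos_iff.2 (sub_ne_zero.2 hzne)) _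
    rw [h2, h3, norm_smul, norm_smul, norm_pow, norm_pow] at h1
    refine le_of_mul_le_mul_left (h1.trans_eq ?_) hpos
    rw [← Nat.sub_add_cancel hlt.le, pow_add, Nat.add_sub_cancel]
    ring
  have hlim : Tendsto (fun z => C * (‖z - z₀‖ ^ (μ - ν) * ‖g₁ z‖)) (𝓝[≠] z₀) (𝓝 0) := by
    have hc : ContinuousAt (fun z => C * (‖z - z₀‖ ^ (μ - ν) * ‖g₁ z‖)) z₀ := by
      have := hg₁.continuousAt
      fun_prop
    have := hc.tendsto
    rw [sub_self, norm_zero, zero_pow (Nat.sub_ne_zero_of_lt hlt), zero_mul, mul_zero] at this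
    exact this.mono_left nhdsWithin_le_nhds
  have hlim' : Tendsto (fun z => ‖h z‖) (𝓝[≠] z₀) (𝓝 ‖h z₀‖) :=
    (hh.continuousAt.norm.tendsto).mono_left nhdsWithin_le_nhds
  have := le_of_tendsto_of_tendsto hlim' hlim hle
  exact hne (norm_le_zero_iff.1 this)

/-- If partial products `∏_{j<k} b j`, up to non-vanishing factors, converge to a non-zero entire
function, then every zero of the limit is a zero of a partial product, of at least the same
order. -/
theorem exists_le_analyticOrderAt_prod {F : ℂ → ℂ} {b e : ℕ → ℂ → ℂ} (hF : Differentiable ℂ F)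
    (hF0 : F ≠ 0) (hb : ∀ j, Differentiable ℂ (b j)) (he : ∀ k, Differentiable ℂ (e k))
    (hlim : ∀ R : ℝ, TendstoUniformlyOn (fun k z => e k z * ∏ j ∈ Finset.range k, b j z) F atTop
      (Metric.closedBall 0 R))
    (hne : ∀ R : ℝ, ∀ᶠ k in atTop, ∀ z ∈ Metric.closedBall (0 : ℂ) R, e k z ≠ 0)
    {z₀ : ℂ} {μ : ℕ} (hμ : μ ≤ analyticOrderAt F z₀) :
    ∃ k, μ ≤ analyticOrderAt (fun z => ∏ j ∈ Finset.range k, b j z) z₀ := by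
  set c : ℕ → ℂ → ℂ := fun k z => ∏ j ∈ Finset.range k, b j z with hc
  have hprod : ∀ s : Finset ℕ, Differentiable ℂ fun z => ∏ j ∈ s, b j z := fun s =>
    Differentiable.fun_finsetProd fun j _ => hb j
  have hcd : ∀ k, Differentiable ℂ (c k) := fun k => hprod _
  by_contra! hlt
  -- choose `K` of maximal order
  have hbdd : BddAbove (Set.range fun k => analyticOrderNatAt (c k) z₀) := by
    refine ⟨μ, ?_⟩
    rintro _ ⟨k, rfl⟩
    have := hlt k
    rw [← Nat.cast_analyticOrderNatAt this.ne_top, Nat.cast_lt] at this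
    exact this.le
  obtain ⟨K, hK⟩ := Nat.sSup_mem (Set.range_nonempty _) hbdd
  have hmax : ∀ k, analyticOrderNatAt (c k) z₀ ≤ analyticOrderNatAt (c K) z₀ := fun k => by
    simp only at hK
    rw [hK]
    exact le_csSup hbdd ⟨k, rfl⟩
  set R : ℕ → ℂ → ℂ := fun k z => ∏ j ∈ Finset.Ico K k, b j z with hR
  have hcR : ∀ k, K ≤ k → ∀ z, c k z = c K z * R k z := fun k hk z =>
    (Finset.prod_range_mul_prod_Ico _ hk).symm
  -- Orders add under products, so maximality of the order at `K` leaves no zero at `z₀` for the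
  -- tail.
  have hR0 : ∀ k, K ≤ k → R k z₀ ≠ 0 := by
    intro k hk
    have h1 : analyticOrderAt (c k) z₀ = analyticOrderAt (c K) z₀ + analyticOrderAt (R k) z₀ := by
      rw [← analyticOrderAt_mul ((hcd K).analyticAt _) ((hprod _).analyticAt _)]
      congr 1
      exact funext (hcR k hk)
    have h2 : analyticOrderAt (R k) z₀ ≠ ⊤ := fun h => by
      rw [h, add_top] at h1
      exact (hlt k).ne_top h1
    rw [← Nat.cast_analyticOrderNatAt (hlt k).ne_top, ← Nat.cast_analyticOrderNatAt (hlt K).ne_top,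
      ← Nat.cast_analyticOrderNatAt h2] at h1
    have h3 : analyticOrderNatAt (R k) z₀ = 0 := by
      have h4 := hmax k
      have : analyticOrderNatAt (c k) z₀ =
        analyticOrderNatAt (c K) z₀ + analyticOrderNatAt (R k) z₀ := by exact_mod_cast h1
      omega
    have h5 : analyticOrderAt (R k) z₀ = 0 := by
      rw [← Nat.cast_analyticOrderNatAt h2, h3, Nat.cast_zero]
    exact (((hprod _).analyticAt z₀).analyticOrderAt_eq_zero).1 h5
  -- a disc in which `z₀` is the only zero of `F`
  have hiso : ∀ᶠ z in 𝓝[≠] z₀, F z ≠ 0 := by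
    refine (hF.analyticAt z₀).eventually_eq_zero_or_eventually_ne_zero.resolve_left fun h => hF0 ?_
    exact (hF.differentiableOn.analyticOnNhd isOpen_univ).eq_of_eventuallyEq
      (g := fun _ => 0) analyticOnNhd_const h
  obtain ⟨ρ', hρ', hball⟩ := Metric.mem_nhdsWithin_iff.1 hiso
  set ρ := ρ' / 2 with hρdef
  have hρ : 0 < ρ := half_pos hρ'
  have hFne : ∀ z ∈ Metric.closedBall z₀ ρ, z ≠ z₀ → F z ≠ 0 := fun z hz hzne =>
    hball ⟨Metric.closedBall_subset_ball (half_lt_self hρ') hz, hzne⟩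
  have hsphere : ∀ z ∈ Metric.sphere z₀ ρ, z ≠ z₀ := fun z hz h => by
    rw [h, Metric.mem_sphere, dist_self] at hz
    exact hρ.ne hz
  have hcs := isCompact_sphere z₀ ρ
  obtain ⟨δ, hδ, hδF⟩ : ∃ δ > 0, ∀ z ∈ Metric.sphere z₀ ρ, δ ≤ ‖F z‖ := by
    have hinv : ContinuousOn (fun z => (F z)⁻¹) (Metric.sphere z₀ ρ) :=
      hF.continuous.continuousOn.inv₀ fun z hz =>
        hFne z (Metric.sphere_subset_closedBall hz) (hsphere z hz)
    obtain ⟨B, hB⟩ := hcs.exists_bound_of_continuousOn hinv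
    refine ⟨(|B| + 1)⁻¹, by positivity, fun z hz => ?_⟩
    have h1 := (hB z hz).trans (le_abs_self B)
    have h2 := norm_pos_iff.2 (hFne z (Metric.sphere_subset_closedBall hz) (hsphere z hz))
    rw [norm_inv] at h1
    exact inv_le_of_inv_le₀ h2 (h1.trans (by linarith))
  obtain ⟨M', hM'⟩ := hcs.exists_bound_of_continuousOn (hcd K).continuous.continuousOn
  set M := |M'| + 1 with hMdef
  have hM : 0 < M := by positivity
  have hMle : ∀ z ∈ Metric.sphere z₀ ρ, ‖c K z‖ ≤ M := fun z hz =>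
    (hM' z hz).trans ((le_abs_self _).trans (by linarith))
  have hsub : Metric.closedBall z₀ ρ ⊆ Metric.closedBall 0 (‖z₀‖ + ρ) := fun z hz => by
    rw [mem_closedBall_zero_iff]
    rw [Metric.mem_closedBall, dist_eq_norm] at hz
    have := norm_sub_norm_le z z₀
    linarith
  have hu := hlim (‖z₀‖ + ρ)
  -- zeros of the partial products are zeros of `F`
  have hzero : ∀ k, ∀ z ∈ Metric.closedBall z₀ ρ, c k z = 0 → F z = 0 := by
    intro k z hz h0
    have ht := hu.tendsto_at (hsub hz)
    refine tendsto_nhds_unique ht (tendsto_const_nhds.congr' ?_)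
    filter_upwards [eventually_ge_atTop k] with k' hk'
    have : c k' z = 0 := by
      rw [hc]
      simp only
      rw [← Finset.prod_range_mul_prod_Ico _ hk']
      exact mul_eq_zero_of_left h0 _
    rw [show ∏ j ∈ Finset.range k', b j z = 0 from this, mul_zero]
  have hRne : ∀ k, K ≤ k → ∀ z ∈ Metric.closedBall z₀ ρ, R k z ≠ 0 := by
    intro k hk z hz h0
    by_cases hzz : z = z₀
    · exact hR0 k hk (hzz ▸ h0)
    · exact hFne z hz hzz (hzero k z hz (by rw [hcR k hk, h0, mul_zero]))
  -- the maximum principle for the inverse of `e k * R k`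
  have hkey : ∀ z ∈ Metric.closedBall z₀ ρ, ‖c K z‖ ≤ 2 * M / δ * ‖F z‖ := by
    intro z hz
    have ht := ((hu.tendsto_at (hsub hz)).norm).const_mul (2 * M / δ)
    refine ge_of_tendsto ht ?_
    filter_upwards [eventually_ge_atTop K, hne (‖z₀‖ + ρ),
      Metric.tendstoUniformlyOn_iff.1 hu (δ / 2) (half_pos hδ)] with k hk hek hdk
    have hcK : ∏ j ∈ Finset.range k, b j z = c K z * R k z := hcR k hk z
    have hQne : ∀ w ∈ Metric.closedBall z₀ ρ, e k w * R k w ≠ 0 := fun w hw =>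
      mul_ne_zero (hek w (hsub hw)) (hRne k hk w hw)
    have hQd : Differentiable ℂ fun w => e k w * R k w := (he k).mul (hprod _)
    have hbound : ‖(e k z * R k z)⁻¹‖ ≤ 2 * M / δ := by
      refine Complex.norm_le_of_forall_mem_frontier_norm_le (U := Metric.ball z₀ ρ)
        (f := fun w => (e k w * R k w)⁻¹) Metric.isBounded_ball ?_ ?_ ?_
      · refine (hQd.diffContOnCl).inv fun w hw => hQne w ?_
        exact Metric.closure_ball_subset_closedBall hw
      · intro w hw
        rw [frontier_ball z₀ hρ.ne'] at hw
        have hwc := Metric.sphere_subset_closedBall hw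
        have h1 := hδF w hw
        have h2 := hdk w (hsub hwc)
        rw [dist_eq_norm, show ∏ j ∈ Finset.range k, b j w = c K w * R k w from hcR k hk w] at h2
        have h3 := norm_sub_norm_le (F w) (e k w * (c K w * R k w))
        -- On the sphere the full product is within `δ / 2` of `F`, and `‖F‖ ≥ δ` there; removing `c
        -- K`, bounded by `M`, bounds the tail from below.
        have h4 : δ / 2 ≤ ‖e k w * R k w‖ * M := by
          calc δ / 2 ≤ ‖e k w * (c K w * R k w)‖ := by linarith
            _ = ‖e k w * R k w‖ * ‖c K w‖ := by rw [← norm_mul]; congr 1; ring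
            _ ≤ _ := by gcongr; exact hMle w hw
        have h5 := norm_pos_iff.2 (hQne w hwc)
        rw [norm_inv, inv_le_comm₀ h5 (by positivity), inv_div, div_le_iff₀ (by positivity)]
        linarith
      · rwa [closure_ball z₀ hρ.ne']
    calc ‖c K z‖ = ‖(e k z * R k z)⁻¹‖ * ‖e k z * (c K z * R k z)‖ := by
          rw [← norm_mul]
          congr 1
          have h1 := left_ne_zero_of_mul (hQne z hz)
          have h2 := right_ne_zero_of_mul (hQne z hz)
          field_simp
      _ ≤ _ := by rw [hcK]; gcongr
  refine (hlt K).not_ge (le_analyticOrderAt_of_norm_le ((hcd K).analyticAt _) (hF.analyticAt _)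
    (C := 2 * M / δ) ?_ hμ)
  filter_upwards [Metric.closedBall_mem_nhds z₀ hρ] with z hz using hkey z hz

/-! ### Exponential polynomials -/

/-- The equation expresses `D^T f` through lower derivatives, since the top coefficient is nonzero;
this gains one derivative at a time. -/
theorem contDiff_infty_of_mem_expPolySpace {T : ℕ} {γ : Fin (T + 1) → ℂ} (hγ : γ (Fin.last T) ≠ 0)
    {f : ℝ → ℂ} (hf : f ∈ expPolySpace T γ) : ContDiff ℝ (⊤ : ℕ∞) f := by
  have htop : deriv^[T] f = fun x => -(γ (Fin.last T))⁻¹ *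
      ∑ j : Fin T, γ j.castSucc * deriv^[(j : ℕ)] f x := by
    ext x
    have h := hf.2 x
    rw [Fin.sum_univ_castSucc] at h
    simp only [Fin.val_castSucc, Fin.val_last, iteratedDeriv_eq_iterate] at h
    field_simp
    linear_combination h
  have key : ∀ n : ℕ, ContDiff ℝ (T + n : ℕ) f := by
    intro n
    induction n with
    | zero => exact hf.1
    | succ n ih =>
      rw [← add_assoc, contDiff_nat_succ_iff_contDiff_one_iteratedDeriv]
      refine ⟨ih, ?_⟩
      have h1 : ContDiff ℝ (1 + n : ℕ) (deriv^[T] f) := by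
        rw [htop]
        refine contDiff_const.mul (ContDiff.sum fun j _ => contDiff_const.mul ?_)
        refine ContDiff.iterate_deriv' (1 + n) (j : ℕ) (ih.of_le ?_)
        have := j.isLt
        exact_mod_cast (by omega : 1 + n + (j : ℕ) ≤ T + n)
      have h2 := ContDiff.iterate_deriv' 1 n h1
      rw [← Function.iterate_add_apply, ← iteratedDeriv_eq_iterate, add_comm n T] at h2
      exact_mod_cast h2
  rw [contDiff_infty]
  intro n
  exact (key n).of_le (by exact_mod_cast Nat.le_add_left n T)

/-- The space of smooth functions `ℝ → ℂ`. -/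
def smoothSpace : Submodule ℂ (ℝ → ℂ) where
  carrier := {f | ContDiff ℝ (⊤ : ℕ∞) f}
  add_mem' hf hg := by
    rw [Set.mem_ofPred_eq] at hf hg ⊢
    exact hf.add hg
  zero_mem' := by
    rw [Set.mem_ofPred_eq]
    exact contDiff_const
  smul_mem' c f hf := by
    rw [Set.mem_ofPred_eq] at hf ⊢
    exact contDiff_const.smul hf

theorem mem_smoothSpace {f : ℝ → ℂ} : f ∈ smoothSpace ↔ ContDiff ℝ (⊤ : ℕ∞) f := Iff.rfl

theorem smoothSpace_differentiable (f : smoothSpace) : Differentiable ℝ (f : ℝ → ℂ) :=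
  (contDiff_infty_iff_deriv.1 (mem_smoothSpace.1 f.2)).1

/-- Differentiation of smooth functions. -/
def diffOp : Module.End ℂ smoothSpace where
  toFun f := ⟨deriv f, (contDiff_infty_iff_deriv.1 f.2).2⟩
  map_add' f g := Subtype.ext <| funext fun x =>
    deriv_add (smoothSpace_differentiable f x) (smoothSpace_differentiable g x)
  map_smul' c f := Subtype.ext <| funext fun x =>
    deriv_const_smul c (smoothSpace_differentiable f x)

theorem coe_diffOp_pow (n : ℕ) (f : smoothSpace) :
    ((diffOp ^ n) f : ℝ → ℂ) = iteratedDeriv n f := by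
  induction n with
  | zero => simp
  | succ n ih =>
    rw [pow_succ', Module.End.mul_apply, iteratedDeriv_succ, ← ih]
    rfl

theorem mem_expPolySpace_iff {T : ℕ} {γ : Fin (T + 1) → ℂ} (hγ : γ (Fin.last T) ≠ 0)
    {f : ℝ → ℂ} : f ∈ expPolySpace T γ ↔
      ∃ hf : f ∈ smoothSpace, aeval diffOp (charPoly γ) ⟨f, hf⟩ = 0 := by
  have key : ∀ (hf : f ∈ smoothSpace) (x : ℝ),
      (aeval diffOp (charPoly γ) ⟨f, hf⟩ : ℝ → ℂ) x =
        ∑ j : Fin (T + 1), γ j * iteratedDeriv (j : ℕ) f x := by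
    intro hf x
    simp only [charPoly, map_sum, map_mul, aeval_C, map_pow, aeval_X, LinearMap.sum_apply,
      Submodule.coe_sum, Finset.sum_apply, Module.End.mul_apply, Module.algebraMap_end_apply,
      Submodule.coe_smul, Pi.smul_apply, smul_eq_mul, coe_diffOp_pow]
  constructor
  · intro h
    have hs : f ∈ smoothSpace := contDiff_infty_of_mem_expPolySpace hγ h
    exact ⟨hs, Subtype.ext <| funext fun x => (key hs x).trans (h.2 x)⟩
  · rintro ⟨hs, h0⟩
    refine ⟨(mem_smoothSpace.1 hs).of_le (by exact_mod_cast le_top), fun x => ?_⟩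
    rw [← key hs x, h0]
    rfl

/-- The function `x ↦ x ^ r * e^{θ x}`. -/
def expMonomial (r : ℕ) (θ : ℂ) : smoothSpace :=
  ⟨fun x => (x : ℂ) ^ r * Complex.exp (θ * x), by
    have h : ContDiff ℝ (⊤ : ℕ∞) fun x : ℝ => (x : ℂ) := Complex.ofRealCLM.contDiff
    exact (h.pow r).mul (Complex.contDiff_exp.comp (contDiff_const.mul h))⟩

theorem expMonomial_apply (r : ℕ) (θ : ℂ) (x : ℝ) :
    (expMonomial r θ : ℝ → ℂ) x = (x : ℂ) ^ r * Complex.exp (θ * x) := rfl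

theorem aeval_X_sub_C_diffOp (θ : ℂ) (f : smoothSpace) :
    aeval diffOp (X - Polynomial.C θ) f = diffOp f - θ • f := by
  simp [LinearMap.sub_apply]

theorem diffOp_expMonomial (r : ℕ) (η : ℂ) :
    diffOp (expMonomial r η) = η • expMonomial r η + (r : ℂ) • expMonomial (r - 1) η := by
  ext x
  have h1 : HasDerivAt (fun x : ℝ => (x : ℂ)) 1 x := Complex.ofRealCLM.hasDerivAt
  have h2 := (h1.pow r).mul ((h1.const_mul η).cexp)
  refine (h2.deriv).trans ?_
  simp only [Submodule.coe_add, Submodule.coe_smul, Pi.add_apply, Pi.smul_apply, smul_eq_mul,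
    expMonomial_apply, Pi.pow_apply]
  ring

theorem aeval_X_sub_C_expMonomial (r : ℕ) (θ η : ℂ) :
    aeval diffOp (X - Polynomial.C θ) (expMonomial r η) =
      (η - θ) • expMonomial r η + (r : ℂ) • expMonomial (r - 1) η := by
  rw [aeval_X_sub_C_diffOp, diffOp_expMonomial]
  module

theorem aeval_expMonomial_eq_zero {P : ℂ[X]} {r : ℕ} {θ : ℂ}
    (h : (X - Polynomial.C θ) ^ (r + 1) ∣ P) : aeval diffOp P (expMonomial r θ) = 0 := by
  obtain ⟨P', rfl⟩ := h
  rw [mul_comm, map_mul, Module.End.mul_apply]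
  suffices aeval diffOp ((X - Polynomial.C θ) ^ (r + 1)) (expMonomial r θ) = 0 by
    rw [this, map_zero]
  clear P'
  induction r with
  | zero =>
    rw [zero_add, pow_one, aeval_X_sub_C_expMonomial]
    simp
  | succ r ih =>
    rw [pow_succ, map_mul, Module.End.mul_apply, aeval_X_sub_C_expMonomial]
    simp only [sub_self, zero_smul, zero_add, map_smul, Nat.add_sub_cancel]
    rw [ih, smul_zero]

/-- The exponential monomials annihilated by `P(D)`. -/
def expMonomials (P : ℂ[X]) : Set smoothSpace :=
  {f | ∃ (r : ℕ) (θ : ℂ), (X - Polynomial.C θ) ^ (r + 1) ∣ P ∧ f = expMonomial r θ}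

/-- `D - θ` can be inverted on exponential monomials: at resonance the power of `x` goes up by one,
matched by the extra factor `X - θ`; otherwise one divides by `η - θ` and corrects the lower term by
induction. -/
theorem exists_aeval_X_sub_C_eq (P : ℂ[X]) (θ : ℂ) {u : smoothSpace}
    (hu : u ∈ Submodule.span ℂ (expMonomials P)) :
    ∃ v ∈ Submodule.span ℂ (expMonomials ((X - Polynomial.C θ) * P)),
      aeval diffOp (X - Polynomial.C θ) v = u := by
  induction hu using Submodule.span_induction with
  | zero => exact ⟨0, Submodule.zero_mem _, map_zero _⟩
  | add u u' _ _ h h' =>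
    obtain ⟨v, hv, e⟩ := h
    obtain ⟨v', hv', e'⟩ := h'
    exact ⟨v + v', Submodule.add_mem _ hv hv', by rw [map_add, e, e']⟩
  | smul c u _ h =>
    obtain ⟨v, hv, e⟩ := h
    exact ⟨c • v, Submodule.smul_mem _ c hv, by rw [map_smul, e]⟩
  | mem u h =>
    obtain ⟨r, η, hd, rfl⟩ := h
    by_cases hη : η = θ
    · subst hη
      refine ⟨((r + 1 : ℕ) : ℂ)⁻¹ • expMonomial (r + 1) η, Submodule.smul_mem _ _
        (Submodule.subset_span ⟨r + 1, η, ?_, rfl⟩), ?_⟩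
      · rw [pow_succ' _ (r + 1)]
        exact mul_dvd_mul_left _ hd
      · rw [map_smul, aeval_X_sub_C_expMonomial, sub_self, zero_smul, zero_add, smul_smul,
          inv_mul_cancel₀ (Nat.cast_ne_zero.2 r.succ_ne_zero), one_smul, Nat.add_sub_cancel]
    · have hne : η - θ ≠ 0 := sub_ne_zero.2 hη
      induction r with
      | zero =>
        refine ⟨(η - θ)⁻¹ • expMonomial 0 η, Submodule.smul_mem _ _
          (Submodule.subset_span ⟨0, η, hd.mul_left _, rfl⟩), ?_⟩
        rw [map_smul, aeval_X_sub_C_expMonomial, Nat.cast_zero, zero_smul, add_zero,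
          inv_smul_smul₀ hne]
      | succ r ih =>
        obtain ⟨v, hv, e⟩ := ih ((pow_dvd_pow _ (Nat.le_succ _)).trans hd)
        refine ⟨(η - θ)⁻¹ • (expMonomial (r + 1) η - ((r + 1 : ℕ) : ℂ) • v),
          Submodule.smul_mem _ _ (Submodule.sub_mem _
            (Submodule.subset_span ⟨r + 1, η, hd.mul_left _, rfl⟩) (Submodule.smul_mem _ _ hv)), ?_⟩
        rw [map_smul, map_sub, map_smul, e, aeval_X_sub_C_expMonomial, Nat.add_sub_cancel,
          add_sub_cancel_right, inv_smul_smul₀ hne]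

/-- Induction on the degree, peeling off a root `θ`: by induction `(D - θ) f` lies in the smaller
span, hence equals `(D - θ) v` with `v` in the required span, and `f - v` solves `w' = θ w`. -/
theorem mem_span_expMonomials {P : ℂ[X]} (hP : P ≠ 0) {f : smoothSpace}
    (hf : aeval diffOp P f = 0) : f ∈ Submodule.span ℂ (expMonomials P) := by
  induction hn : P.natDegree generalizing P f with
  | zero =>
    rw [eq_C_of_natDegree_eq_zero hn] at hf hP
    rw [aeval_C, Module.algebraMap_end_apply, smul_eq_zero] at hf
    rw [hf.resolve_left fun h => hP (by rw [h, Polynomial.C_0])]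
    exact Submodule.zero_mem _
  | succ n ih =>
    obtain ⟨θ, hθ⟩ := IsAlgClosed.exists_root P fun h => by
      have := natDegree_eq_zero_iff_degree_le_zero.2 h.le
      omega
    obtain ⟨P', rfl⟩ := dvd_iff_isRoot.2 hθ
    have hP' : P' ≠ 0 := right_ne_zero_of_mul hP
    rw [natDegree_mul (X_sub_C_ne_zero θ) hP', natDegree_X_sub_C] at hn
    have hu : aeval diffOp P' (aeval diffOp (X - Polynomial.C θ) f) = 0 := by
      rw [← Module.End.mul_apply, ← map_mul, mul_comm, hf]
    obtain ⟨v, hv, e⟩ := exists_aeval_X_sub_C_eq P' θ (ih hP' hu (by omega))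
    have h0 : diffOp (f - v) = θ • (f - v) := by
      rw [← sub_eq_zero, ← aeval_X_sub_C_diffOp, map_sub, e, sub_self]
    set w := f - v with hw
    have hw0 : w = (w : ℝ → ℂ) 0 • expMonomial 0 θ := by
      have hder : ∀ x : ℝ, HasDerivAt (fun x : ℝ => (w : ℝ → ℂ) x * Complex.exp (-θ * x)) 0 x := by
        intro x
        have h1 : HasDerivAt (fun x : ℝ => (x : ℂ)) 1 x := Complex.ofRealCLM.hasDerivAt
        have h2 : HasDerivAt (w : ℝ → ℂ) (θ * (w : ℝ → ℂ) x) x := by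
          have := (smoothSpace_differentiable w x).hasDerivAt
          have e2 : deriv (w : ℝ → ℂ) x = θ * (w : ℝ → ℂ) x :=
            congrFun (congrArg Subtype.val h0) x
          rwa [e2] at this
        have h3 := h2.mul ((h1.const_mul (-θ)).cexp)
        convert! h3 using 1
        ring
      ext x
      have h4 := is_const_of_deriv_eq_zero (fun x => (hder x).differentiableAt)
        (fun x => (hder x).deriv) x 0
      simp only [Complex.ofReal_zero, mul_zero, Complex.exp_zero, mul_one] at h4
      rw [Submodule.coe_smul, Pi.smul_apply, smul_eq_mul, expMonomial_apply, pow_zero, one_mul,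
        ← h4, mul_assoc, ← Complex.exp_add]
      simp
    have hwm : w ∈ Submodule.span ℂ (expMonomials ((X - Polynomial.C θ) * P')) := by
      rw [hw0]
      exact Submodule.smul_mem _ _ (Submodule.subset_span ⟨0, θ, by simp, rfl⟩)
    have : f = w + v := by rw [hw, sub_add_cancel]
    rw [this]
    exact Submodule.add_mem _ hwm hv

theorem charPoly_ne_zero {T : ℕ} {γ : Fin (T + 1) → ℂ} (hγ : γ (Fin.last T) ≠ 0) :
    charPoly γ ≠ 0 := by
  intro h
  have h1 : (charPoly γ).coeff T = γ (Fin.last T) := by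
    simp only [charPoly, finsetSum_coeff, coeff_C_mul, coeff_X_pow]
    rw [Finset.sum_eq_single (Fin.last T)]
    · simp
    · intro j _ hj
      rw [if_neg, mul_zero]
      intro h
      exact hj (Fin.ext h.symm)
    · simp
  rw [h, coeff_zero] at h1
  exact hγ h1.symm

theorem charPoly_eval {T : ℕ} (γ : Fin (T + 1) → ℂ) (z : ℂ) :
    (charPoly γ).eval z = ∑ j : Fin (T + 1), γ j * z ^ (j : ℕ) := by
  simp [charPoly, eval_finsetSum]

/-- Integration by parts; the quasi-periodicity makes the boundary terms cancel. -/
theorem integral_exp_mul_deriv {f : ℝ → ℂ} (hf : ContDiff ℝ 1 f) {Λ : ℂ}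
    (hp : f 1 = Complex.exp Λ * f 0) :
    ∫ x in (0 : ℝ)..1, Complex.exp (-(Λ * x)) * deriv f x =
      Λ * ∫ x in (0 : ℝ)..1, Complex.exp (-(Λ * x)) * f x := by
  have h1 : ∀ x : ℝ, HasDerivAt (fun x : ℝ => Complex.exp (-(Λ * x)))
      (-Λ * Complex.exp (-(Λ * x))) x := by
    intro x
    have h1 : HasDerivAt (fun x : ℝ => (x : ℂ)) 1 x := Complex.ofRealCLM.hasDerivAt
    convert! (h1.const_mul Λ).fun_neg.cexp using 1
    ring
  have hc := hf.continuous_deriv le_rfl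
  have h := intervalIntegral.integral_mul_deriv_eq_deriv_mul (a := (0 : ℝ)) (b := 1)
    (fun x _ => h1 x) (fun x _ => ((hf.differentiable one_ne_zero) x).hasDerivAt)
    ((by fun_prop : Continuous _).intervalIntegrable _ _) (hc.intervalIntegrable _ _)
  rw [h, hp, ← mul_assoc, ← Complex.exp_add]
  simp only [mul_assoc, intervalIntegral.integral_const_mul]
  simp

/-- If `f` in the space satisfies `f (x + 1) = e^Λ f x`, then `∫ e^{-Λ x} f x` over a period
vanishes unless `Λ` is a characteristic root. -/
theorem integral_exp_mul_eq_zero {T : ℕ} {γ : Fin (T + 1) → ℂ} {f : ℝ → ℂ}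
    (hf : f ∈ expPolySpace T γ) {Λ : ℂ} (hp : ∀ x, f (x + 1) = Complex.exp Λ * f x)
    (hΛ : ¬ (charPoly γ).IsRoot Λ) :
    ∫ x in (0 : ℝ)..1, Complex.exp (-(Λ * x)) * f x = 0 := by
  have hper : ∀ (j : ℕ) (x : ℝ), iteratedDeriv j f (x + 1) = Complex.exp Λ * iteratedDeriv j f x := by
    intro j
    induction j with
    | zero => simpa using hp
    | succ j ih =>
      intro x
      rw [iteratedDeriv_succ, ← deriv_comp_add_const, funext ih]
      exact deriv_const_mul_field _
  have hI : ∀ j : ℕ, j ≤ T → ∫ x in (0 : ℝ)..1, Complex.exp (-(Λ * x)) * iteratedDeriv j f x =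
      Λ ^ j * ∫ x in (0 : ℝ)..1, Complex.exp (-(Λ * x)) * f x := by
    intro j hj
    induction j with
    | zero => simp
    | succ j ih =>
      have hcd : ContDiff ℝ 1 (iteratedDeriv j f) := by
        rw [iteratedDeriv_eq_iterate]
        have := ContDiff.iterate_deriv' 1 j (hf.1.of_le (n := T) (by exact_mod_cast (by omega : 1 + j ≤ T)))
        exact_mod_cast this
      have h1 := hper j 0
      rw [zero_add] at h1
      rw [iteratedDeriv_succ, integral_exp_mul_deriv hcd h1, ih (by omega)]
      ring
  -- Integrating the differential equation against `e^{-Λx}` gives `γ(Λ)` times the wanted integral.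
  have hsum : ∑ j : Fin (T + 1), γ j *
      ∫ x in (0 : ℝ)..1, Complex.exp (-(Λ * x)) * iteratedDeriv (j : ℕ) f x = 0 := by
    simp only [← intervalIntegral.integral_const_mul]
    rw [← intervalIntegral.integral_finsetSum]
    · have : ∀ x : ℝ, ∑ j : Fin (T + 1), γ j * (Complex.exp (-(Λ * x)) * iteratedDeriv (j : ℕ) f x)
          = 0 := by
        intro x
        have := hf.2 x
        calc _ = Complex.exp (-(Λ * x)) * ∑ j : Fin (T + 1), γ j * iteratedDeriv (j : ℕ) f x := by
              rw [Finset.mul_sum]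
              exact Finset.sum_congr rfl fun j _ => by ring
          _ = 0 := by rw [this, mul_zero]
      simp [this]
    · intro j _
      have hc := hf.1.continuous_iteratedDeriv (j : ℕ) (by exact_mod_cast Fin.is_le j)
      exact (by fun_prop : Continuous fun x : ℝ =>
        γ j * (Complex.exp (-(Λ * x)) * iteratedDeriv (j : ℕ) f x)).intervalIntegrable _ _
  rw [Finset.sum_congr rfl fun (j : Fin (T + 1)) _ => by rw [hI j (Fin.is_le j), ← mul_assoc],
    ← Finset.sum_mul, ← charPoly_eval] at hsum
  exact (mul_eq_zero.1 hsum).resolve_left hΛ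

/-! ### Generation and reproduction in terms of moments -/

section
variable {J : Finset ℤ} {Q : (ℤ → ℂ) → ℝ → ℂ}

theorem IsLocalOperator.shift_int (hQ : IsLocalOperator J Q) (n : ℤ) :
    ∀ (q : ℤ → ℂ) (x : ℝ), Q (fun j => q (j + n)) x = Q q (x + n) := by
  have hneg : ∀ (q : ℤ → ℂ) (x : ℝ), Q (fun j => q (j - 1)) x = Q q (x - 1) := by
    intro q x
    have := hQ.shift (fun j => q (j - 1)) (x - 1)
    simpa using this.symm
  induction n using Int.induction_on with
  | zero => simp
  | succ n ih =>
    intro q x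
    have h1 := ih (fun j => q (j + 1)) x
    rw [hQ.shift] at h1
    push_cast at h1 ⊢
    rw [← add_assoc, ← h1]
    simp only [add_assoc]
  | pred n ih =>
    intro q x
    have h1 := ih (fun j => q (j - 1)) x
    rw [hneg] at h1
    push_cast at h1 ⊢
    rw [← add_sub_assoc, ← h1]
    simp only [add_sub_assoc]

/-- Dedekind's independence of the characters `z ↦ z ^ j` of `ℂˣ`, with `θ = log z`; evaluation at 2
shows that they are distinct. -/
theorem eq_zero_of_forall_sum_exp_eq_zero {w : ℤ → ℂ}
    (h : ∀ θ : ℂ, ∑ j ∈ J, w j * Complex.exp (θ * j) = 0) : ∀ j ∈ J, w j = 0 := by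
  let f : ℤ → ℂˣ →* ℂ := fun j => (Units.coeHom ℂ).comp (zpowGroupHom j)
  have hf : Function.Injective f := by
    intro i j hij
    have h2 := DFunLike.congr_fun hij (Units.mk0 2 two_ne_zero)
    have h3 : (2 : ℂ) ^ i = 2 ^ j := by simpa [f, zpowGroupHom] using h2
    have h4 : ((2 : ℝ) ^ i : ℝ) = 2 ^ j := Complex.ofReal_injective (by push_cast; exact h3)
    exact zpow_right_injective₀ two_pos (by norm_num) h4
  have hli := (linearIndependent_monoidHom ℂˣ ℂ).comp f hf
  refine linearIndependent_iff'.1 hli J w (funext fun z => ?_)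
  have h1 := h (Complex.log z)
  rw [Finset.sum_apply]
  simp only [Pi.smul_apply, smul_eq_mul, Function.comp_apply, Pi.zero_apply]
  rw [← h1]
  refine Finset.sum_congr rfl fun j _ => ?_
  congr 1
  rw [mul_comm, Complex.exp_int_mul, Complex.exp_log z.ne_zero]
  simp [f, zpowGroupHom]

/-- A non-zero local operator has a non-zero moment. -/
theorem IsLocalOperator.moment_ne_zero (hQ : IsLocalOperator J Q) (c : ℝ) {q : ℤ → ℂ}
    (hq : Q q ≠ 0) : moment Q c 0 ≠ 0 := by
  intro h0
  refine hq (funext fun y => ?_)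
  -- The moment vanishes at every `θ + 2πi m`, so all Fourier coefficients of the twisted function
  -- vanish.
  have htw : ∀ θ x, twisted Q c 0 θ x = 0 := by
    intro θ x
    rw [eq_integral_of_fourier_coeff_eq_zero (hQ.continuous_twisted c 0 θ)
      (hQ.twisted_periodic c 0 θ)]
    · exact congrFun h0 θ
    · intro m _
      have h := hQ.moment_add_two_pi c 0 θ m
      rw [h0, Pi.zero_apply, zero_eq_mul] at h
      exact h.resolve_left (Complex.exp_ne_zero _)
  have hunit : ∀ x ∈ Set.Icc (0 : ℝ) 1, ∀ q, Q q x = 0 := by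
    intro x hx q
    rw [hQ.eq_sum hx]
    refine Finset.sum_eq_zero fun j hj => ?_
    rw [eq_zero_of_forall_sum_exp_eq_zero (w := fun j => Q (Pi.single j 1) x) _ j hj, mul_zero]
    intro θ
    have h := htw θ x
    rw [twisted, hQ.eq_sum hx] at h
    have h2 : ∑ j ∈ J, expData 0 θ (c - x) j * Q (Pi.single j 1) x =
        Complex.exp (θ * (c - x)) * ∑ j ∈ J, Q (Pi.single j 1) x * Complex.exp (θ * j) := by
      rw [Finset.mul_sum]
      refine Finset.sum_congr rfl fun j _ => ?_
      have : θ * ((c - x + j : ℝ) : ℂ) = θ * (c - x) + θ * j := by push_cast; ring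
      rw [expData, pow_zero, one_mul, this, Complex.exp_add]
      ring
    rw [h2] at h
    exact (mul_eq_zero.1 h).resolve_left (Complex.exp_ne_zero _)
  have h := hQ.shift_int ⌊y⌋ q (Int.fract y)
  rw [Int.fract_add_floor] at h
  rw [← h, hunit _ ⟨Int.fract_nonneg y, (Int.fract_lt_one y).le⟩, Pi.zero_apply]

/-- Binomial expansion of `c = (c - x) + x`: the image of an exponential monomial is a combination
of exponential monomials with 1-periodic coefficients. -/
theorem IsLocalOperator.map_expData_eq_sum (hQ : IsLocalOperator J Q) (c : ℝ) (r : ℕ) (θ : ℂ)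
    (x : ℝ) :
    Q (expData r θ c) x = ∑ s ∈ Finset.range (r + 1),
      ((x : ℂ) ^ (r - s) * (r.choose s) * Complex.exp (θ * x)) * twisted Q c s θ x := by
  have h := hQ.map_expData_add r θ (c - x) x x
  rwa [sub_add_cancel] at h

variable {T : ℕ} {γ : Fin (T + 1) → ℂ}

theorem sampled_expMonomial (c : ℝ) (r : ℕ) (θ : ℂ) :
    (fun i : ℤ => (expMonomial r θ : ℝ → ℂ) (c + i)) = expData r θ c := rfl

theorem expMonomial_mem_expPolySpace (hγ : γ (Fin.last T) ≠ 0) {r : ℕ} {θ : ℂ}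
    (h : (X - Polynomial.C θ) ^ (r + 1) ∣ charPoly γ) :
    (expMonomial r θ : ℝ → ℂ) ∈ expPolySpace T γ :=
  (mem_expPolySpace_iff hγ).2 ⟨(expMonomial r θ).2, aeval_expMonomial_eq_zero h⟩

/-- The space `V_{T,γ}` as a subspace. -/
def expPolySubmodule (γ : Fin (T + 1) → ℂ) : Submodule ℂ (ℝ → ℂ) :=
  (LinearMap.ker (aeval diffOp (charPoly γ))).map smoothSpace.subtype

theorem mem_expPolySubmodule (hγ : γ (Fin.last T) ≠ 0) {f : ℝ → ℂ} :
    f ∈ expPolySubmodule γ ↔ f ∈ expPolySpace T γ := by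
  rw [mem_expPolySpace_iff hγ]
  simp [expPolySubmodule]

theorem not_isRoot_add_two_pi
    (hsep : ∀ θ θ' : ℂ, (charPoly γ).IsRoot θ → (charPoly γ).IsRoot θ' →
      Complex.exp θ = Complex.exp θ' → θ = θ') {θ : ℂ} (hθ : (charPoly γ).IsRoot θ) {m : ℤ}
    (hm : m ≠ 0) : ¬ (charPoly γ).IsRoot (θ + 2 * Real.pi * Complex.I * m) := by
  intro h
  have he : Complex.exp θ = Complex.exp (θ + 2 * Real.pi * Complex.I * m) := by
    rw [mul_comm _ (m : ℂ), Complex.exp_periodic.int_mul]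
  have h0 := hsep _ _ hθ h he
  rw [left_eq_add, mul_eq_zero] at h0
  rcases h0 with h0 | h0
  · exact Complex.two_pi_I_ne_zero h0
  · exact hm (by exact_mod_cast h0)

/-- An operator that maps samples of functions in `V_{T,γ}` to functions in `V_{T,γ}` has vanishing
moments at the translates of the characteristic roots. -/
theorem IsLocalOperator.moment_eq_zero_of_generates (hQ : IsLocalOperator J Q)
    (hγ : γ (Fin.last T) ≠ 0)
    (hsep : ∀ θ θ' : ℂ, (charPoly γ).IsRoot θ → (charPoly γ).IsRoot θ' →
      Complex.exp θ = Complex.exp θ' → θ = θ') {c : ℝ}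
    (hgen : ∀ f ∈ expPolySpace T γ, Q (fun i => f (c + i)) ∈ expPolySpace T γ)
    {r : ℕ} {θ : ℂ} (h : (X - Polynomial.C θ) ^ (r + 1) ∣ charPoly γ) {m : ℤ} (hm : m ≠ 0) :
    moment Q c r (θ + 2 * Real.pi * Complex.I * m) = 0 := by
  have hroot : (charPoly γ).IsRoot θ := dvd_iff_isRoot.1 ((dvd_pow_self _ r.succ_ne_zero).trans h)
  induction r using Nat.strong_induction_on generalizing m with
  | _ r ih =>
    have hdvd : ∀ s ≤ r, (X - Polynomial.C θ) ^ (s + 1) ∣ charPoly γ := fun s hs =>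
      (pow_dvd_pow _ (Nat.succ_le_succ hs)).trans h
    -- By the induction hypothesis the lower twisted functions have only a zeroth Fourier
    -- coefficient.
    have hconst : ∀ s < r, ∀ x, twisted Q c s θ x = ∫ y in (0 : ℝ)..1, twisted Q c s θ y := by
      intro s hs x
      refine eq_integral_of_fourier_coeff_eq_zero (hQ.continuous_twisted c s θ)
        (hQ.twisted_periodic c s θ) (fun m' hm' => ?_) x
      have h1 := ih s hs (hdvd s hs.le) hm'
      rw [hQ.moment_add_two_pi, mul_eq_zero] at h1
      exact h1.resolve_left (Complex.exp_ne_zero _)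
    -- In the expansion of `Q (expData r θ c)` all other terms are now constant multiples of
    -- exponential monomials in the space, so the remaining term `g` lies in the space too.
    set g : ℝ → ℂ := fun x => Complex.exp (θ * x) * twisted Q c r θ x with hg
    have hgV : g ∈ expPolySpace T γ := by
      have h1 : g = Q (expData r θ c) - ∑ s ∈ Finset.range r,
          ((r.choose s : ℂ) * ∫ y in (0 : ℝ)..1, twisted Q c s θ y) •
            (expMonomial (r - s) θ : ℝ → ℂ) := by
        ext x
        rw [Pi.sub_apply, hQ.map_expData_eq_sum, Finset.sum_range_succ, Finset.sum_apply,
          Finset.sum_congr rfl fun s hs => by rw [hconst s (Finset.mem_range.1 hs) x]]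
        simp only [Pi.smul_apply, smul_eq_mul, expMonomial_apply, hg]
        rw [eq_sub_iff_add_eq, add_comm]
        congr 1
        · exact Finset.sum_congr rfl fun s _ => by ring
        · simp
      rw [← mem_expPolySubmodule hγ, h1]
      refine Submodule.sub_mem _ ?_ (Submodule.sum_mem _ fun s hs => Submodule.smul_mem _ _ ?_)
      · rw [mem_expPolySubmodule hγ, ← sampled_expMonomial]
        exact hgen _ (expMonomial_mem_expPolySpace hγ h)
      · rw [mem_expPolySubmodule hγ]
        exact expMonomial_mem_expPolySpace hγ (hdvd _ (Nat.sub_le _ _))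
    rw [hQ.moment_add_two_pi, mul_eq_zero]
    right
    -- `g` is quasi-periodic with factor `e^θ = e^{θ + 2πi m}`, and `θ + 2πi m` is not a root by the
    -- separation hypothesis.
    have hI := integral_exp_mul_eq_zero hgV (Λ := θ + 2 * Real.pi * Complex.I * m)
      (fun x => by
        have he : Complex.exp (θ + 2 * Real.pi * Complex.I * m) = Complex.exp θ := by
          rw [mul_comm _ (m : ℂ), Complex.exp_periodic.int_mul]
        rw [he]
        simp only [hg]
        rw [hQ.twisted_periodic c r θ x, ← mul_assoc, ← Complex.exp_add]
        congr 2
        push_cast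
        ring)
      (not_isRoot_add_two_pi hsep hroot hm)
    rw [← hI]
    refine intervalIntegral.integral_congr fun x _ => ?_
    simp only [hg]
    rw [← mul_assoc, ← Complex.exp_add]
    congr 2
    ring

/-- An interpolating operator with vanishing moments at the translates of the characteristic roots
reproduces `V_{T,γ}`. -/
theorem IsLocalOperator.map_samples_eq (hQ : IsLocalOperator J Q) (hγ : γ (Fin.last T) ≠ 0)
    {c : ℝ} (hint : ∀ q, Q q c = q 0)
    (hmom : ∀ (r : ℕ) (θ : ℂ), (X - Polynomial.C θ) ^ (r + 1) ∣ charPoly γ → ∀ m : ℤ, m ≠ 0 →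
      moment Q c r (θ + 2 * Real.pi * Complex.I * m) = 0)
    {f : ℝ → ℂ} (hf : f ∈ expPolySpace T γ) : Q (fun i => f (c + i)) = f := by
  obtain ⟨hs, h0⟩ := (mem_expPolySpace_iff hγ).1 hf
  have hspan := mem_span_expMonomials (charPoly_ne_zero hγ) h0
  suffices H : ∀ F ∈ Submodule.span ℂ (expMonomials (charPoly γ)),
      Q (fun i => (F : ℝ → ℂ) (c + i)) = (F : ℝ → ℂ) from H _ hspan
  intro F hF
  induction hF using Submodule.span_induction with
  | zero =>
    ext x
    have := hQ.smul 0 0 x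
    rw [zero_smul, zero_mul] at this
    exact this
  | add F G _ _ hF hG =>
    ext x
    have := hQ.add (fun i => (F : ℝ → ℂ) (c + i)) (fun i => (G : ℝ → ℂ) (c + i)) x
    rw [hF, hG] at this
    exact this
  | smul a F _ hF =>
    ext x
    have := hQ.smul a (fun i => (F : ℝ → ℂ) (c + i)) x
    rw [hF] at this
    exact this
  | mem F hF =>
    obtain ⟨r, θ, hd, rfl⟩ := hF
    rw [sampled_expMonomial]
    -- The twisted function is constant by its Fourier coefficients. Interpolation computes it at `x
    -- = c`, where it is the sample `0 ^ s * e^0`.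
    have htw : ∀ s ≤ r, ∀ x, twisted Q c s θ x = if s = 0 then 1 else 0 := by
      intro s hs x
      have hconst := eq_integral_of_fourier_coeff_eq_zero (hQ.continuous_twisted c s θ)
        (hQ.twisted_periodic c s θ) fun m hm => by
          have h1 := hmom s θ ((pow_dvd_pow _ (Nat.succ_le_succ hs)).trans hd) m hm
          rw [hQ.moment_add_two_pi, mul_eq_zero] at h1
          exact h1.resolve_left (Complex.exp_ne_zero _)
      rw [hconst x, ← hconst c, twisted, hint, sub_self]
      rcases eq_or_ne s 0 with rfl | hs0
      · simp [expData]
      · simp [expData, hs0]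
    ext x
    rw [hQ.map_expData_eq_sum, Finset.sum_eq_single 0]
    · rw [htw 0 (Nat.zero_le _)]
      simp [expMonomial_apply]
    · intro s hs hs0
      rw [htw s (Nat.lt_succ_iff.1 (Finset.mem_range.1 hs)), if_neg hs0, mul_zero]
    · simp

end

/-! ### Limits of moments -/

section
variable {τ : ℕ → ℝ} {a : ℕ → ℝ[T;T⁻¹]} {J : Finset ℤ} {Q : (ℤ → ℂ) → ℝ → ℂ}

/-- From the limit back to finite products: zeros of the limiting moment come from finitely many
symbols. -/
theorem exists_le_analyticOrderAt_symbolProd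
    (hJ : ∀ k, IsLocalOperator J (schemePolygon τ a k)) (hQ : IsLocalOperator J Q)
    (hlim : ∀ q, IsLimitFunction τ a q (Q q)) {q : ℤ → ℂ} (hq : Q q ≠ 0) (c : ℝ) {μ : ℕ} {Λ : ℂ}
    (hμ : μ ≤ analyticOrderAt (moment Q c 0) Λ) :
    ∃ k, μ ≤ analyticOrderAt (symbolProd a k) Λ := by
  refine exists_le_analyticOrderAt_prod (F := moment Q c 0)
    (b := fun j Λ => symbolEval (a j) (Λ / 2 ^ (j + 1)) / 2)
    (e := fun k Λ => Complex.exp (Λ * (c - τ k)) * hatTransform (Λ / 2 ^ k))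
    (hQ.differentiable_moment c 0) (hQ.moment_ne_zero c hq) ?_ ?_ ?_ ?_ hμ
  · intro j
    have := differentiable_symbolEval (a j)
    fun_prop
  · intro k
    have := differentiable_hatTransform
    fun_prop
  · intro R
    refine (tendstoUniformlyOn_moment hQ hJ hlim c 0 R).congr (Eventually.of_forall fun k Λ _ => ?_)
    exact moment_schemePolygon τ a c k (hJ k) Λ
  · intro R
    filter_upwards [eventually_hatTransform_ne_zero R] with k hk Λ hΛ
    exact mul_ne_zero (Complex.exp_ne_zero _) (hk Λ hΛ)

theorem analyticOrderAt_symbolProd_mono (a : ℕ → ℝ[T;T⁻¹]) (Λ : ℂ) :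
    Monotone fun k => analyticOrderAt (symbolProd a k) Λ := by
  refine monotone_nat_of_le_succ fun k => ?_
  have h : symbolProd a (k + 1) =
      symbolProd a k * fun Λ => symbolEval (a k) (Λ / 2 ^ (k + 1)) / 2 :=
    funext fun Λ => Finset.prod_range_succ _ _
  have hd : Differentiable ℂ fun Λ => symbolEval (a k) (Λ / 2 ^ (k + 1)) / 2 := by
    have := differentiable_symbolEval (a k)
    fun_prop
  rw [h, analyticOrderAt_mul ((differentiable_symbolProd a k).analyticAt _) (hd.analyticAt _)]
  exact le_self_add

/-- The opposite direction: a zero of one partial product persists in all later ones, hence in the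
moments of the interpolants, and passes to their limit. -/
theorem moment_eq_zero_of_le_analyticOrderAt_symbolProd
    (hJ : ∀ k, IsLocalOperator J (schemePolygon τ a k)) (hQ : IsLocalOperator J Q)
    (hlim : ∀ q, IsLimitFunction τ a q (Q q)) (c : ℝ) {μ K : ℕ} {Λ : ℂ}
    (hμ : μ ≤ analyticOrderAt (symbolProd a K) Λ) {r : ℕ} (hr : r < μ) : moment Q c r Λ = 0 := by
  have ht := (tendstoUniformlyOn_moment hQ hJ hlim c r ‖Λ‖).tendsto_at
    (x := Λ) (by rw [mem_closedBall_zero_iff])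
  refine tendsto_nhds_unique ht (tendsto_const_nhds.congr' ?_)
  filter_upwards [eventually_ge_atTop K] with k hk
  refine (((hJ k).le_analyticOrderAt_moment_iff c μ Λ).1 ?_ r hr).symm
  have h : moment (schemePolygon τ a k) c 0 =
      (fun Λ => Complex.exp (Λ * (c - τ k)) * hatTransform (Λ / 2 ^ k)) * symbolProd a k :=
    funext fun Λ => moment_schemePolygon τ a c k (hJ k) Λ
  have hd : Differentiable ℂ fun Λ => Complex.exp (Λ * (c - τ k)) * hatTransform (Λ / 2 ^ k) := by
    have := differentiable_hatTransform
    fun_prop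
  rw [h, analyticOrderAt_mul (hd.analyticAt _) ((differentiable_symbolProd a k).analyticAt _)]
  exact (hμ.trans (analyticOrderAt_symbolProd_mono a Λ hk)).trans le_add_self

theorem analyticOrderAt_symbolProd_mul_le (a b : ℕ → ℝ[T;T⁻¹]) (k : ℕ) (Λ : ℂ) :
    analyticOrderAt (symbolProd a k) Λ ≤ analyticOrderAt (symbolProd (fun j => a j * b j) k) Λ := by
  have h : symbolProd (fun j => a j * b j) k =
      symbolProd a k * fun Λ => ∏ j ∈ Finset.range k, symbolEval (b j) (Λ / 2 ^ (j + 1)) := by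
    ext Λ
    simp only [symbolProd, Pi.mul_apply, symbolEval_mul]
    rw [← Finset.prod_mul_distrib]
    exact Finset.prod_congr rfl fun j _ => by ring
  have hd : Differentiable ℂ fun Λ => ∏ j ∈ Finset.range k, symbolEval (b j) (Λ / 2 ^ (j + 1)) := by
    refine Differentiable.fun_finsetProd fun j _ => ?_
    have := differentiable_symbolEval (b j)
    fun_prop
  rw [h, analyticOrderAt_mul ((differentiable_symbolProd a k).analyticAt _) (hd.analyticAt _)]
  exact le_self_add

end

/-! ### The Bezout polynomials -/

theorem negArg_add (a b : ℝ[X]) : negArg (a + b) = negArg a + negArg b := add_comp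

theorem negArg_mul (a b : ℝ[X]) : negArg (a * b) = negArg a * negArg b := mul_comp _ _ _

theorem negArg_C (r : ℝ) : negArg (Polynomial.C r) = Polynomial.C r := C_comp

theorem negArg_negArg (a : ℝ[X]) : negArg (negArg a) = a := by
  simp [negArg, comp_assoc]

theorem natDegree_negArg (a : ℝ[X]) : (negArg a).natDegree = a.natDegree := by
  simp [negArg, natDegree_comp]

theorem degree_negArg (a : ℝ[X]) : (negArg a).degree = a.degree := by
  rcases eq_or_ne a 0 with rfl | ha
  · simp [negArg]
  · have hne : negArg a ≠ 0 := fun h => ha <| by rw [← negArg_negArg a, h]; simp [negArg]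
    rw [degree_eq_natDegree ha, degree_eq_natDegree hne, natDegree_negArg]

theorem negArg_two_mul_X_pow (e : ℕ) :
    negArg (2 * X ^ e) = Polynomial.C ((-1) ^ e) * (2 * X ^ e) := by
  simp only [negArg, mul_comp, pow_comp, X_comp, ofNat_comp]
  rw [neg_pow]
  simp only [map_pow, map_neg, map_one]
  ring

theorem coeff_negArg (a : ℝ[X]) (l : ℕ) : (negArg a).coeff l = (-1) ^ l * a.coeff l := by
  induction a using Polynomial.induction_on' with
  | add p q hp hq => rw [negArg_add, coeff_add, coeff_add, hp, hq, mul_add]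
  | monomial n r =>
    have : negArg (monomial n r) = Polynomial.C ((-1) ^ n * r) * X ^ n := by
      rw [negArg, ← C_mul_X_pow_eq_monomial, mul_comp, C_comp, pow_comp, X_comp, neg_pow]
      simp only [map_mul, map_pow, map_neg, map_one]
      ring
    rw [this, coeff_C_mul_X_pow, coeff_monomial]
    by_cases h : n = l
    · subst h; simp
    · rw [if_neg (Ne.symm h), if_neg h, mul_zero]

theorem Star.sign_mul_self (s : Star) : s.sign * s.sign = 1 := by
  cases s <;> simp [Star.sign]

/-- The exponent `2i - ℓ` is even for `+` and odd for `-`, so the right-hand side of the Bezout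
identity has the same symmetry under `z ↦ -z` as the left. -/
theorem Star.sign_mul_neg_one_pow (s : Star) {i : ℕ} (hi : 1 ≤ i) :
    s.sign * (-1) ^ (2 * i - s.ell) = 1 := by
  cases s
  · have : 2 * i - 2 = 2 * (i - 1) := by omega
    simp [Star.sign, Star.ell, this, pow_mul]
  · have : 2 * i - 1 = 2 * (i - 1) + 1 := by omega
    simp [Star.sign, Star.ell, this, pow_add, pow_mul]

theorem Star.one_le_ell (s : Star) : 1 ≤ s.ell := by
  cases s <;> simp [Star.ell]

/-- The solutions of `a u + b v = f` with `deg u < deg b` are unique if `a`, `b` are coprime. -/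
theorem eq_of_mul_add_mul_eq {a b u u' v v' : ℝ[X]} (hab : IsCoprime a b)
    (hu : u.degree < b.degree) (hu' : u'.degree < b.degree)
    (h : a * u + b * v = a * u' + b * v') : u = u' := by
  have hd : b ∣ a * (u - u') := ⟨v' - v, by linear_combination h⟩
  have h0 := eq_zero_of_dvd_of_degree_lt (hab.symm.dvd_of_dvd_mul_left hd)
    ((degree_sub_le _ _).trans_lt (max_lt hu hu'))
  exact sub_eq_zero.1 h0

theorem exists_mul_add_mul_eq {a b f : ℝ[X]} {n : ℕ} (hab : IsCoprime a b)
    (ha : a.degree = n) (hb : b.degree = n) (hf : f.degree < (2 * n : ℕ)) :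
    ∃ u v : ℝ[X], u.degree < n ∧ v.degree < n ∧ a * u + b * v = f := by
  have hb0 : b ≠ 0 := fun h => by simp [h] at hb
  obtain ⟨x, y, hxy⟩ := hab
  have hmod := EuclideanDomain.div_add_mod (f * x) b
  have hu : ((f * x) % b).degree < n := hb ▸ degree_mod_lt _ hb0
  have heq : a * ((f * x) % b) + b * (f * y + a * ((f * x) / b)) = f := by
    linear_combination a * hmod + f * hxy
  refine ⟨(f * x) % b, f * y + a * ((f * x) / b), hu, ?_, heq⟩
  -- If `v` had degree at least `n`, then `b v` would have degree at least `2n`, but it equals `f -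
  -- a u`, of smaller degree.
  by_contra hv
  rw [not_lt] at hv
  set w := f * y + a * ((f * x) / b)
  have h1 : ((2 * n : ℕ) : WithBot ℕ) ≤ (b * w).degree := by
    rw [degree_mul, hb, two_mul, Nat.cast_add]
    gcongr
  have h2 : (a * ((f * x) % b)).degree < (2 * n : ℕ) := by
    rcases eq_or_ne ((f * x) % b) 0 with h0 | h0
    · rw [h0, mul_zero, Polynomial.degree_zero]
      exact WithBot.bot_lt_coe _
    · rw [degree_eq_natDegree h0, Nat.cast_lt] at hu
      rw [degree_mul, ha, degree_eq_natDegree h0, ← Nat.cast_add, Nat.cast_lt]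
      omega
  have h3 : b * w = f - a * ((f * x) % b) := by linear_combination heq
  rw [h3] at h1
  exact h1.not_gt ((degree_sub_le _ _).trans_lt (max_lt hf h2))

theorem existsUnique_isBezoutPoly {a : ℝ[X]} (ha : IsCoprime a (negArg a)) (s : Star) {i : ℕ}
    (hi : 1 ≤ i) (hin : i ≤ a.natDegree) : ∃! p, IsBezoutPoly a s i p := by
  have ha0 : a ≠ 0 := fun h => by rw [h, natDegree_zero] at hin; omega
  have hdeg : a.degree = a.natDegree := degree_eq_natDegree ha0
  have hdeg' : (negArg a).degree = a.natDegree := (degree_negArg a).trans hdeg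
  set e := 2 * i - s.ell with he
  have hlt : (2 * X ^ e : ℝ[X]).degree < (2 * a.natDegree : ℕ) := by
    have h2 : (2 : ℝ[X]) = Polynomial.C 2 := rfl
    rw [h2, degree_C_mul_X_pow e two_ne_zero, Nat.cast_lt]
    have := s.one_le_ell
    omega
  have hσ : Polynomial.C s.sign * Polynomial.C ((-1) ^ e) = (1 : ℝ[X]) := by
    rw [← Polynomial.C_mul, s.sign_mul_neg_one_pow hi, Polynomial.C_1]
  have hσσ : Polynomial.C s.sign * Polynomial.C s.sign = (1 : ℝ[X]) := by
    rw [← Polynomial.C_mul, s.sign_mul_self, Polynomial.C_1]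
  obtain ⟨u, v, hu, hv, huv⟩ := exists_mul_add_mul_eq ha hdeg hdeg' hlt
  refine ⟨u, ⟨hu, ?_⟩, ?_⟩
  -- Replacing `z` by `-z` yields a second solution of the same equation; uniqueness identifies `v`
  -- with the signed reflection of `u`.
  · have h1 := congrArg negArg huv
    rw [negArg_add, negArg_mul, negArg_mul, negArg_negArg, negArg_two_mul_X_pow] at h1
    have h2 : a * (Polynomial.C s.sign * negArg v) + negArg a * (Polynomial.C s.sign * negArg u) =
        a * u + negArg a * v := by
      rw [huv]
      linear_combination Polynomial.C s.sign * h1 + 2 * X ^ e * hσ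
    have h3 : Polynomial.C s.sign * negArg v = u := by
      refine eq_of_mul_add_mul_eq ha ?_ (hdeg' ▸ hu) h2
      have hs : s.sign ≠ 0 := left_ne_zero_of_mul_eq_one s.sign_mul_self
      rw [degree_C_mul hs, degree_negArg, hdeg']
      exact hv
    have h4 : negArg u = Polynomial.C s.sign * v := by
      rw [← h3, negArg_mul, negArg_C, negArg_negArg]
    rw [h4, ← he]
    linear_combination huv + negArg a * v * hσσ
  · rintro p ⟨hp, hpe⟩
    refine eq_of_mul_add_mul_eq (v := Polynomial.C s.sign * negArg p) (v' := v) ha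
      (hdeg' ▸ hp) (hdeg' ▸ hu) ?_
    rw [huv, ← hpe]
    ring

/-! ### The interpolatory symbols -/

theorem coeff_toLaurent_natCast (P : ℝ[X]) (l : ℕ) : (toLaurent P).coeff (l : ℤ) = P.coeff l := by
  rw [coeff_toLaurent]
  exact Finsupp.mapDomain_apply Nat.castEmbedding.injective _ _

theorem coeff_toLaurent_of_neg (P : ℝ[X]) {l : ℤ} (hl : l < 0) : (toLaurent P).coeff l = 0 := by
  rw [coeff_toLaurent]
  refine Finsupp.mapDomain_of_notMem_range _ _ ?_
  rintro ⟨n, rfl⟩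
  simp only [Nat.castEmbedding_apply] at hl
  omega

theorem coeff_mul_T (f : ℝ[T;T⁻¹]) (n l : ℤ) :
    (f * LaurentPolynomial.T n).coeff l = f.coeff (l - n) := by
  rw [LaurentPolynomial.T, AddMonoidAlgebra.coeff_mul_single_apply, mul_one, sub_eq_add_neg]

/-- The Bezout identity doubles the coefficients of `a p` whose index has the parity of `e = 2i -
ℓ`, so among these only the one at `e` survives. Division by `z^e` moves them to even positions: the
symbol is interpolatory. -/
theorem coeff_interpSymbol_even {a p : ℝ[X]} {s : Star} {i : ℕ} (hi : 1 ≤ i)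
    (hp : IsBezoutPoly a s i p) (d : ℤ) :
    (interpSymbol a s i p).coeff (2 * d) = if d = 0 then 1 else 0 := by
  have hell : s.ell ≤ 2 * i := by cases s <;> simp [Star.ell] <;> omega
  set e := 2 * i - s.ell with he
  have hez : (2 * (i : ℤ) - (s.ell : ℤ)) = e := by omega
  rw [interpSymbol, coeff_mul_T, sub_neg_eq_add, hez]
  rcases lt_or_ge (2 * d + e) 0 with hneg | hnn
  · rw [coeff_toLaurent_of_neg _ hneg, if_neg (by omega)]
  · obtain ⟨l, hl⟩ := Int.eq_ofNat_of_zero_le hnn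
    have h1 := congrArg (fun P => P.coeff l) hp.2
    have h2 : (2 : ℝ[X]) = Polynomial.C 2 := rfl
    simp only [coeff_add, coeff_C_mul, ← negArg_mul, coeff_negArg, ← he, h2, coeff_X_pow] at h1
    have hsgn : s.sign * (-1) ^ l = 1 := by
      have hpar : Even l ↔ Even e := by
        rw [← Int.even_coe_nat l, ← Int.even_coe_nat e, ← hl]
        simp [Int.even_add]
      suffices hpow : (-1 : ℝ) ^ l = (-1) ^ e by rw [hpow, s.sign_mul_neg_one_pow hi]
      rcases Nat.even_or_odd e with h | h
      · rw [h.neg_one_pow, (hpar.2 h).neg_one_pow]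
      · have hlo : Odd l := Nat.not_even_iff_odd.1 fun h' => Nat.not_even_iff_odd.2 h (hpar.1 h')
        rw [h.neg_one_pow, hlo.neg_one_pow]
    rw [← mul_assoc, hsgn, one_mul] at h1
    rw [hl, coeff_toLaurent_natCast]
    by_cases hd : d = 0
    · rw [if_pos (by omega)] at h1
      rw [if_pos hd]
      linarith
    · rw [if_neg (by omega)] at h1
      rw [if_neg hd]
      linarith

theorem subdivOp_even {a : ℝ[T;T⁻¹]} (ha : ∀ d : ℤ, a.coeff (2 * d) = if d = 0 then 1 else 0)
    (q : ℤ → ℂ) (i : ℤ) : subdivOp a q (2 * i) = q i := by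
  rw [subdivOp, finsum_eq_single _ i]
  · have := ha 0
    rw [mul_zero, if_pos rfl] at this
    simp [this]
  · intro j hj
    have h := ha (i - j)
    rw [if_neg (sub_ne_zero.2 hj.symm), mul_sub] at h
    rw [h]
    simp

theorem subdivData_two_pow_mul {a : ℕ → ℝ[T;T⁻¹]}
    (ha : ∀ k, ∀ d : ℤ, (a k).coeff (2 * d) = if d = 0 then 1 else 0) (q : ℤ → ℂ) (k : ℕ) (i : ℤ) :
    subdivData a q k (2 ^ k * i) = q i := by
  induction k with
  | zero => simp [subdivData]
  | succ k ih => rw [subdivData, pow_succ', mul_assoc, subdivOp_even (ha k), ih]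

/-- The datum at index 0 never changes and, the parameters having a fixed origin, always sits at
`τ₀`. -/
theorem limit_apply_of_interpolatory {a : ℕ → ℝ[T;T⁻¹]}
    (ha : ∀ k, ∀ d : ℤ, (a k).coeff (2 * d) = if d = 0 then 1 else 0) {τ₀ : ℝ} {q : ℤ → ℂ}
    {g : ℝ → ℂ} (hg : IsLimitFunction (fun _ => τ₀) a q g) : g τ₀ = q 0 := by
  refine tendsto_nhds_unique (hg.tendsto τ₀) (tendsto_const_nhds.congr fun k => ?_)
  have h := polygon_gridPoint (fun _ => τ₀) k (subdivData a q k) (2 ^ k * 0)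
  rw [subdivData_two_pow_mul ha] at h
  rw [schemePolygon, ← h]
  simp [gridPoint]

/-- Any convergent interpolatory scheme whose symbols are multiples of generating ones reproduces
the space. The base points `τ 0` and `τ₀` may differ because zeros are transferred through
`symbolProd`, which does not involve the parameters. -/
theorem reproduces_of_generates {T : ℕ} {γ : Fin (T + 1) → ℂ} (hγ : γ (Fin.last T) ≠ 0)
    (hsep : ∀ θ θ' : ℂ, (charPoly γ).IsRoot θ → (charPoly γ).IsRoot θ' →
      Complex.exp θ = Complex.exp θ' → θ = θ')
    {τ : ℕ → ℝ} {a b : ℕ → ℝ[T;T⁻¹]} (hgen : Generates τ a (expPolySpace T γ))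
    (hb : ∀ k, ∀ d : ℤ, (a k * b k).coeff (2 * d) = if d = 0 then 1 else 0) {τ₀ : ℝ}
    (hconv : Convergent (fun _ => τ₀) fun k => a k * b k) :
    Reproduces (fun _ => τ₀) (fun k => a k * b k) (expPolySpace T γ) := by
  refine ⟨hconv, fun f hf => ?_⟩
  obtain ⟨J, hJ⟩ := hgen.1.exists_window
  choose Q hQ using hgen.1.1
  have hloc := isLocalOperator_limit hJ hQ
  obtain ⟨J', hJ'⟩ := hconv.exists_window
  choose Q' hQ' using hconv.1
  have hloc' := isLocalOperator_limit hJ' hQ'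
  have hgrid : ∀ (σ : ℕ → ℝ) (i : ℤ), gridPoint σ 0 i = σ 0 + i := by simp [gridPoint]
  have hV : ∀ f ∈ expPolySpace T γ, Q (fun i => f (τ 0 + i)) ∈ expPolySpace T γ := by
    intro f hf
    obtain ⟨g, hg, hlim⟩ := hgen.2 f hf
    simp only [hgrid] at hlim
    rwa [(hQ _).unique hlim]
  obtain ⟨q, hq⟩ : ∃ q, Q q ≠ 0 := by
    obtain ⟨q, g, hg, hne⟩ := hgen.1.2
    exact ⟨q, by rwa [(hQ q).unique hg]⟩
  have hmom : ∀ (r : ℕ) (θ : ℂ), (X - Polynomial.C θ) ^ (r + 1) ∣ charPoly γ → ∀ m : ℤ, m ≠ 0 →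
      moment Q' τ₀ r (θ + 2 * Real.pi * Complex.I * m) = 0 := by
    intro r θ hd m hm
    have hord : ((r + 1 : ℕ) : ℕ∞) ≤
        analyticOrderAt (moment Q (τ 0) 0) (θ + 2 * Real.pi * Complex.I * m) :=
      (hloc.le_analyticOrderAt_moment_iff _ _ _).2 fun s hs =>
        hloc.moment_eq_zero_of_generates hγ hsep hV ((pow_dvd_pow _ hs).trans hd) hm
    obtain ⟨K, hK⟩ := exists_le_analyticOrderAt_symbolProd
      (fun k => isLocalOperator_schemePolygon (hJ k)) hloc hQ hq (τ 0) hord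
    exact moment_eq_zero_of_le_analyticOrderAt_symbolProd
      (fun k => isLocalOperator_schemePolygon (hJ' k)) hloc' hQ' τ₀
      (hK.trans (analyticOrderAt_symbolProd_mul_le a b K _)) r.lt_succ_self
  have hlim := hQ' fun i => f (τ₀ + i)
  rw [hloc'.map_samples_eq hγ (fun q => limit_apply_of_interpolatory hb (hQ' q)) hmom hf] at hlim
  simpa only [hgrid] using hlim

end ExpSubdivision

end

/-! ### Proof of the proposition -/

theorem mainTheorem1
    (T : ℕ) (γ : Fin (T + 1) → ℂ) (hγ : γ (Fin.last T) ≠ 0)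
    (hsep : ∀ θ θ' : ℂ, (ExpSubdivision.charPoly γ).IsRoot θ →
      (ExpSubdivision.charPoly γ).IsRoot θ' → Complex.exp θ = Complex.exp θ' → θ = θ')
    (a : ℕ → ℝ[X])
    (hcop : ∀ k, IsCoprime (a k) (ExpSubdivision.negArg (a k)))
    (τ : ℕ → ℝ)
    (hgen : ExpSubdivision.Generates τ (fun k => Polynomial.toLaurent (a k))
      (ExpSubdivision.expPolySpace T γ)) :
    (∀ (k : ℕ) (s : ExpSubdivision.Star) (i : ℕ), 1 ≤ i → i ≤ (a k).natDegree →
      ∃! p : ℝ[X], ExpSubdivision.IsBezoutPoly (a k) s i p) ∧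
    ∀ (s : ℕ → ExpSubdivision.Star) (i : ℕ → ℕ) (p : ℕ → ℝ[X]),
      (∀ k, 1 ≤ i k ∧ i k ≤ (a k).natDegree) →
      (∀ k, ExpSubdivision.IsBezoutPoly (a k) (s k) (i k) (p k)) →
      ∀ τ₀ : ℝ,
        ExpSubdivision.Convergent (fun _ => τ₀)
          (fun k => ExpSubdivision.interpSymbol (a k) (s k) (i k) (p k)) →
        ExpSubdivision.Reproduces (fun _ => τ₀)
          (fun k => ExpSubdivision.interpSymbol (a k) (s k) (i k) (p k))
          (ExpSubdivision.expPolySpace T γ) := by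
  refine ⟨fun k s i hi hin => ExpSubdivision.existsUnique_isBezoutPoly (hcop k) s hi hin, ?_⟩
  intro s i p hi hp τ₀ hconv
  -- Grouping `p` with the negative power of `z` exhibits the new symbol as a Laurent multiple of
  -- the original one.
  have hsymb : ∀ k, ExpSubdivision.interpSymbol (a k) (s k) (i k) (p k) =
      toLaurent (a k) *
        (toLaurent (p k) * LaurentPolynomial.T (-(2 * (i k : ℤ) - ((s k).ell : ℤ)))) := by
    intro k
    rw [ExpSubdivision.interpSymbol, map_mul, mul_assoc]
  have hint := fun k => ExpSubdivision.coeff_interpSymbol_even (hi k).1 (hp k)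
  simp only [hsymb] at hconv hint ⊢
  exact ExpSubdivision.reproduces_of_generates hγ hsep hgen hint hconv
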